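/- Let $F$ be a field of characteristic $0$; all algebras are over $F$ and need not be associative or unital. Let $\mathfrak N=\mathrm{NAlt}^{(2)}$ be the variety of all algebras satisfying $(xx)y=x(xy)$, $(xy)y=x(yy)$, $(xy)(zt)=0$ and $x^3=0$ (metabelian alternative nil-algebras of index at most $3$). For $n\ge 1$ let $\mathfrak N_n$ be the subvariety of $\mathfrak N$ generated by the free $\mathfrak N$-algebra $F_{\mathfrak N}[x_1,\dots,x_n]$ on $n$ generators, i.e. the class of all algebras satisfying all identities of this free algebra. For a superalgebra ($\mathbb Z_2$-graded algebra) $A=A_0\oplus A_1$ let $\mathrm G(A)=\mathrm G_0\otimes A_0+\mathrm G_1\otimes A_1$ be its Grassmann envelope, where $\mathrm G=\mathrm G_0\oplus \mathrm G_1$ is the Grassmann algebra on countably many generators. For a multilinear polynomial $f$, the superalgebra $A$ satisfies the superidentity $\tilde f=0$ if and only if $\mathrm G(A)$ satisfies $f=0$. An $\mathfrak N$-superalgebra is a superalgebra $A$ with $\mathrm G(A)\in\mathfrak N$; let $\widetilde{\mathfrak N}$ be the class of all of them. For $r,s\ge 0$ let $\mathfrak N_{r,s}$ be the supervariety generated by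 the free $\mathfrak N$-superalgebra on $r$ even and $s$ odd generators, i.e. the class of all superalgebras satisfying every superidentity $\tilde f=0$ ($f$ multilinear) that holds in this free superalgebra; $\mathfrak N_{0,0}$ consists of zero superalgebras. The basic spectrum of $\mathfrak N$ is the set of all pairs $(r,s)$ of nonnegative integers that are minimal, for the componentwise order, with the property $\mathfrak N_{r,s}=\widetilde{\mathfrak N}$. Theorem. (1) The basic spectrum of $\mathrm{NAlt}^{(2)}$ is $\{(0,1)\}$. (2) For every $n\ge 1$ the inclusion $\mathrm{NAlt}^{(2)}_n\subset \mathrm{NAlt}^{(2)}_{n+1}$ is strict. (3) For every $n\ge 1$ the index of nilpotency of the free $\mathrm{NAlt}^{(2)}$-algebra $A$ on $n$ generators is $n+2$, i.e. $n+2$ is the least $k\ge 1$ such that $A^k=0$, where $A^k$ is the span of all products of $k$ elements of $A$ with arbitrary arrangement of parentheses. -/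

import Mathlib

open scoped TensorProduct

namespace NilAlt

universe u

noncomputable section

/-! ## Algebras, ideals and quotients -/

/-- A (not necessarily associative, not necessarily unital) algebra over the field `F`. -/
structure Alg (F : Type u) [Field F] where
  carrier : Type u
  [ring : NonUnitalNonAssocRing carrier]
  [module : Module F carrier]
  [tower : IsScalarTower F carrier carrier]
  [comm : SMulCommClass F carrier carrier]

attribute [instance] Alg.ring Alg.module Alg.tower Alg.comm

/-- A two-sided ideal of an algebra, closed under scalars. -/
structure AlgIdeal (F : Type u) [Field F] (A : Type u) [NonUnitalNonAssocRing A] [Module F A] where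
  toSubmodule : Submodule F A
  mul_mem_left : ∀ a b : A, b ∈ toSubmodule → a * b ∈ toSubmodule
  mul_mem_right : ∀ a b : A, a ∈ toSubmodule → a * b ∈ toSubmodule

namespace AlgIdeal

variable {F : Type u} [Field F] {A : Type u} [NonUnitalNonAssocRing A] [Module F A]

/-- The quotient of an algebra by an ideal. -/
def Quot (I : AlgIdeal F A) : Type u := A ⧸ I.toSubmodule

instance (I : AlgIdeal F A) : AddCommGroup I.Quot :=
  inferInstanceAs (AddCommGroup (A ⧸ I.toSubmodule))

instance (I : AlgIdeal F A) : Module F I.Quot :=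
  inferInstanceAs (Module F (A ⧸ I.toSubmodule))

/-- The canonical projection onto the quotient. -/
def proj (I : AlgIdeal F A) : A →ₗ[F] I.Quot := I.toSubmodule.mkQ

theorem proj_surjective (I : AlgIdeal F A) : Function.Surjective I.proj :=
  Submodule.mkQ_surjective I.toSubmodule

theorem proj_eq_zero (I : AlgIdeal F A) (a : A) : I.proj a = 0 ↔ a ∈ I.toSubmodule :=
  Submodule.Quotient.mk_eq_zero I.toSubmodule

variable [IsScalarTower F A A] [SMulCommClass F A A]

/-- The multiplication of the quotient, as a bilinear map. -/
def mulQ (I : AlgIdeal F A) : I.Quot →ₗ[F] I.Quot →ₗ[F] I.Quot :=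
  Submodule.liftQ I.toSubmodule
    (LinearMap.flip (Submodule.liftQ I.toSubmodule
      (LinearMap.flip ((LinearMap.mul F A).compr₂ I.proj))
      (fun b hb => by
        ext a
        exact (I.proj_eq_zero _).2 (I.mul_mem_left a b hb))))
    (fun a ha => by
      ext b
      obtain ⟨b, rfl⟩ := I.proj_surjective b
      exact (I.proj_eq_zero _).2 (I.mul_mem_right a b ha))

instance (I : AlgIdeal F A) : NonUnitalNonAssocRing I.Quot where
  mul a b := I.mulQ a b
  left_distrib a b c := (I.mulQ a).map_add b c
  right_distrib a b c := I.mulQ.map_add₂ a b c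
  zero_mul a := I.mulQ.map_zero₂ a
  mul_zero a := (I.mulQ a).map_zero

instance (I : AlgIdeal F A) : IsScalarTower F I.Quot I.Quot where
  smul_assoc c a b := I.mulQ.map_smul₂ c a b

instance (I : AlgIdeal F A) : SMulCommClass F I.Quot I.Quot where
  smul_comm c a b := ((I.mulQ a).map_smul c b).symm

theorem proj_mul (I : AlgIdeal F A) (a b : A) : I.proj (a * b) = I.proj a * I.proj b := rfl

end AlgIdeal

/-! ## Nonassociative words and polynomials -/

/-- The multiset of letters of a nonassociative word. -/
def letters {X : Type*} : FreeMagma X → Multiset X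
  | .of x => {x}
  | .mul v w => letters v + letters w

/-- The monomial of the free nonassociative algebra given by a nonassociative word. -/
abbrev monomial (F : Type*) [Field F] {X : Type*} (w : FreeMagma X) :
    FreeNonUnitalNonAssocAlgebra F X :=
  MonoidAlgebra.single w 1

/-- The multilinear polynomials of degree `n` in the variables `x_0, …, x_{n-1}`: linear
combinations of words containing every variable exactly once. -/
def multilinear (F : Type*) [Field F] (n : ℕ) :
    Submodule F (FreeNonUnitalNonAssocAlgebra F (Fin n)) :=
  Submodule.span F {f | ∃ w : FreeMagma (Fin n), letters w = Finset.univ.val ∧ f = monomial F w}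

/-- `f = 0` is an identity of the algebra `A`. -/
def Satisfies {F : Type u} [Field F] (A : Alg F) {X : Type*}
    (f : FreeNonUnitalNonAssocAlgebra F X) : Prop :=
  ∀ v : X → A.carrier, FreeNonUnitalNonAssocAlgebra.lift F v f = 0

/-- The power `A ^ k` of a nonassociative algebra: the span of all products of `k` elements of
`A`, with all arrangements of parentheses (meaningful for `k ≥ 1`). -/
def power {F : Type u} [Field F] (A : Alg F) (k : ℕ) : Submodule F A.carrier :=
  Submodule.span F {a | ∃ w : FreeMagma A.carrier,
    (letters w).card = k ∧ FreeMagma.lift (id : A.carrier → A.carrier) w = a}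

/-- `k` is the index of nilpotency of `A`: the least `k ≥ 1` with `A ^ k = 0`. -/
def IsNilpotencyIndex {F : Type u} [Field F] (A : Alg F) (k : ℕ) : Prop :=
  IsLeast {k | 1 ≤ k ∧ power A k = ⊥} k

/-! ## Free algebras of a variety and the chain of subvarieties -/

/-- The ideal of all polynomials in the variables `X` that are identities of every algebra
of `V`. -/
def identityIdeal {F : Type u} [Field F] (V : Set (Alg F)) (X : Type) :
    AlgIdeal F (FreeNonUnitalNonAssocAlgebra F X) where
  toSubmodule :=
    { carrier := {f | ∀ A ∈ V, Satisfies A f}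
      add_mem' := fun hf hg A hA v => by rw [map_add, hf A hA v, hg A hA v, add_zero]
      zero_mem' := fun A _ v => map_zero _
      smul_mem' := fun c f hf A hA v => by rw [map_smul, hf A hA v, smul_zero] }
  mul_mem_left a b hb := fun A hA v => by rw [map_mul, hb A hA v, mul_zero]
  mul_mem_right a b ha := fun A hA v => by rw [map_mul, ha A hA v, zero_mul]

/-- The free algebra of the variety `V` on `n` generators. -/
def freeAlg {F : Type u} [Field F] (V : Set (Alg F)) (n : ℕ) : Alg F where
  carrier := (identityIdeal V (Fin n)).Quot

/-- The variety `V_n` generated by the free `V`-algebra on `n` generators: all algebras that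
satisfy every identity of this free algebra. -/
def rankVariety {F : Type u} [Field F] (V : Set (Alg F)) (n : ℕ) : Set (Alg F) :=
  {B | ∀ f : FreeNonUnitalNonAssocAlgebra F ℕ, Satisfies (freeAlg V n) f → Satisfies B f}

/-! ## Superalgebras and Grassmann envelopes -/

/-- A superalgebra over `F`: an algebra `A = A_0 ⊕ A_1` with `A_i A_j ⊆ A_{i+j}`. -/
structure SuperAlg (F : Type u) [Field F] extends Alg F where
  part : ZMod 2 → Submodule F carrier
  isCompl : IsCompl (part 0) (part 1)
  mul_mem : ∀ {i j : ZMod 2} {a b : carrier}, a ∈ part i → b ∈ part j → a * b ∈ part (i + j)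

/-- The Grassmann algebra on the countable set of generators `e_0, e_1, …`. -/
abbrev Grassmann (F : Type u) [Field F] : Type u := ExteriorAlgebra F (ℕ →₀ F)

/-- The even (`i = 0`) and odd (`i = 1`) parts of the Grassmann algebra, spanned by the products
of an even, respectively odd, number of generators. -/
def Grassmann.part (F : Type u) [Field F] (i : ZMod 2) : Submodule F (Grassmann F) :=
  CliffordAlgebra.evenOdd (0 : QuadraticForm F (ℕ →₀ F)) i

/-- The subspace `G_0 ⊗ A_0 + G_1 ⊗ A_1` of `G ⊗ A`. -/
def envelopeSubmodule {F : Type u} [Field F] (A : SuperAlg F) :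
    Submodule F (Grassmann F ⊗[F] A.carrier) :=
  ⨆ i : ZMod 2, Submodule.map₂ (TensorProduct.mk F (Grassmann F) A.carrier)
    (Grassmann.part F i) (A.part i)

theorem envelopeSubmodule_mul_mem {F : Type u} [Field F] (A : SuperAlg F)
    {a b : Grassmann F ⊗[F] A.carrier} (ha : a ∈ envelopeSubmodule A)
    (hb : b ∈ envelopeSubmodule A) : a * b ∈ envelopeSubmodule A := by
  have key : ∀ (i j : ZMod 2) (g : Grassmann F) (x : A.carrier) (h : Grassmann F)
      (y : A.carrier), g ∈ Grassmann.part F i → x ∈ A.part i → h ∈ Grassmann.part F j →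
      y ∈ A.part j → (g ⊗ₜ[F] x) * (h ⊗ₜ[F] y) ∈ envelopeSubmodule A := by
    intro i j g x h y hg hx hh hy
    rw [Algebra.TensorProduct.tmul_mul_tmul]
    refine Submodule.mem_iSup_of_mem (i + j) (Submodule.apply_mem_map₂ _ ?_ (A.mul_mem hx hy))
    exact CliffordAlgebra.evenOdd_mul_le _ i j (Submodule.mul_mem_mul hg hh)
  induction ha using Submodule.iSup_induction' with
  | zero => rw [zero_mul]; exact Submodule.zero_mem _
  | add a a' _ _ h h' => rw [add_mul]; exact Submodule.add_mem _ h h'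
  | mem i a ha =>
    induction hb using Submodule.iSup_induction' with
    | zero => rw [mul_zero]; exact Submodule.zero_mem _
    | add b b' _ _ h h' => rw [mul_add]; exact Submodule.add_mem _ h h'
    | mem j b hb =>
      rw [Submodule.map₂_eq_span_image2] at ha hb
      induction ha using Submodule.span_induction with
      | zero => rw [zero_mul]; exact Submodule.zero_mem _
      | add a a' _ _ h h' => rw [add_mul]; exact Submodule.add_mem _ h h'
      | smul c a _ h => rw [smul_mul_assoc]; exact Submodule.smul_mem _ c h
      | mem a ha =>
        obtain ⟨g, hg, x, hx, rfl⟩ := ha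
        induction hb using Submodule.span_induction with
        | zero => rw [mul_zero]; exact Submodule.zero_mem _
        | add b b' _ _ h h' => rw [mul_add]; exact Submodule.add_mem _ h h'
        | smul c b _ h => rw [mul_smul_comm]; exact Submodule.smul_mem _ c h
        | mem b hb =>
          obtain ⟨h, hh, y, hy, rfl⟩ := hb
          exact key i j g x h y hg hx hh hy

/-- The Grassmann envelope as a subalgebra of `G ⊗ A`. -/
def envelopeSubalgebra {F : Type u} [Field F] (A : SuperAlg F) :
    NonUnitalSubalgebra F (Grassmann F ⊗[F] A.carrier) :=
  { envelopeSubmodule A with mul_mem' := fun ha hb => envelopeSubmodule_mul_mem A ha hb }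

/-- The Grassmann envelope `G(A) = G_0 ⊗ A_0 + G_1 ⊗ A_1` of a superalgebra. -/
def envelope {F : Type u} [Field F] (A : SuperAlg F) : Alg F where
  carrier := envelopeSubalgebra A

/-- The class of `V`-superalgebras: superalgebras whose Grassmann envelope lies in `V`. -/
def superClass {F : Type u} [Field F] (V : Set (Alg F)) : Set (SuperAlg F) :=
  {A | envelope A ∈ V}

/-- The superalgebra `A` satisfies the superidentity corresponding to the multilinear
polynomial `f`, that is, the Grassmann envelope of `A` satisfies `f = 0`. -/
def SatisfiesSuper {F : Type u} [Field F] (A : SuperAlg F) {n : ℕ}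
    (f : FreeNonUnitalNonAssocAlgebra F (Fin n)) : Prop :=
  Satisfies (envelope A) f

/-! ## Free superalgebras -/

/-- The parity of a word in `r` even letters `inl i` and `s` odd letters `inr j`: the number of
its odd letters modulo `2`. -/
def parity {r s : ℕ} (w : FreeMagma (Fin r ⊕ Fin s)) : ZMod 2 :=
  ((letters w).countP (fun x => x.isRight = true) : ZMod 2)

/-- The span of the words of parity `i`. -/
def wordPart (F : Type u) [Field F] (r s : ℕ) (i : ZMod 2) :
    Submodule F (FreeNonUnitalNonAssocAlgebra F (Fin r ⊕ Fin s)) :=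
  Submodule.span F {f | ∃ w, parity w = i ∧ f = monomial F w}

theorem parity_mul {r s : ℕ} (v w : FreeMagma (Fin r ⊕ Fin s)) :
    parity (v * w) = parity v + parity w := by
  have : letters (v * w) = letters v + letters w := rfl
  simp [parity, this]

theorem coeff_eq_zero_of_mem_wordPart {F : Type u} [Field F] {r s : ℕ} {i : ZMod 2}
    {f : FreeNonUnitalNonAssocAlgebra F (Fin r ⊕ Fin s)} (hf : f ∈ wordPart F r s i)
    (w : FreeMagma (Fin r ⊕ Fin s)) (hw : parity w ≠ i) : f.coeff w = 0 := by
  classical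
  induction hf using Submodule.span_induction with
  | zero => rfl
  | add a b _ _ ha hb => simp [ha, hb]
  | smul c a _ ha => simp [ha]
  | mem a ha =>
    obtain ⟨v, hv, rfl⟩ := ha
    have : v ≠ w := by rintro rfl; exact hw hv
    simp [monomial, this]

theorem isCompl_wordPart (F : Type u) [Field F] (r s : ℕ) :
    IsCompl (wordPart F r s 0) (wordPart F r s 1) := by
  constructor
  · rw [Submodule.disjoint_def]
    intro f h0 h1
    ext w
    by_cases hw : parity w = 0
    · exact coeff_eq_zero_of_mem_wordPart h1 w (by rw [hw]; decide)
    · exact coeff_eq_zero_of_mem_wordPart h0 w hw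
  · rw [codisjoint_iff, eq_top_iff]
    intro f _
    induction f using MonoidAlgebra.induction_linear with
    | zero => exact Submodule.zero_mem _
    | add f g hf hg => exact Submodule.add_mem _ (hf trivial) (hg trivial)
    | single w c =>
      have h : (MonoidAlgebra.single w c : FreeNonUnitalNonAssocAlgebra F (Fin r ⊕ Fin s))
          = c • monomial F w := by simp [monomial]
      rw [h]
      refine Submodule.smul_mem _ c ?_
      have h01 : ∀ p : ZMod 2, p = 0 ∨ p = 1 := by decide
      rcases h01 (parity w) with hw | hw
      · exact Submodule.mem_sup_left (Submodule.subset_span ⟨w, hw, rfl⟩)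
      · exact Submodule.mem_sup_right (Submodule.subset_span ⟨w, hw, rfl⟩)

theorem wordPart_mul_mem {F : Type u} [Field F] {r s : ℕ} {i j : ZMod 2}
    {a b : FreeNonUnitalNonAssocAlgebra F (Fin r ⊕ Fin s)} (ha : a ∈ wordPart F r s i)
    (hb : b ∈ wordPart F r s j) : a * b ∈ wordPart F r s (i + j) := by
  induction ha using Submodule.span_induction with
  | zero => rw [zero_mul]; exact Submodule.zero_mem _
  | add a a' _ _ h h' => rw [add_mul]; exact Submodule.add_mem _ h h'
  | smul c a _ h => rw [smul_mul_assoc]; exact Submodule.smul_mem _ c h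
  | mem a ha =>
    obtain ⟨v, hv, rfl⟩ := ha
    induction hb using Submodule.span_induction with
    | zero => rw [mul_zero]; exact Submodule.zero_mem _
    | add b b' _ _ h h' => rw [mul_add]; exact Submodule.add_mem _ h h'
    | smul c b _ h => rw [mul_smul_comm]; exact Submodule.smul_mem _ c h
    | mem b hb =>
      obtain ⟨w, hw, rfl⟩ := hb
      refine Submodule.subset_span ⟨v * w, by rw [parity_mul, hv, hw], ?_⟩
      simp [monomial, MonoidAlgebra.single_mul_single]

/-- The variables are sent to homogeneous elements of the right parity. -/
def IsGraded {F : Type u} [Field F] (B : SuperAlg F) {r s : ℕ}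
    (v : Fin r ⊕ Fin s → B.carrier) : Prop :=
  (∀ i, v (Sum.inl i) ∈ B.part 0) ∧ (∀ j, v (Sum.inr j) ∈ B.part 1)

theorem lift_monomial {F : Type u} [Field F] {X : Type*} (B : Alg F) (v : X → B.carrier)
    (w : FreeMagma X) :
    FreeNonUnitalNonAssocAlgebra.lift F v (monomial F w) = FreeMagma.lift v w := by
  induction w using FreeMagma.recOnMul with
  | ih1 x => exact FreeNonUnitalNonAssocAlgebra.lift_of_apply F v x
  | ih2 x y hx hy =>
    have : monomial F (x * y) = monomial F x * monomial F y := by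
      simp [monomial, MonoidAlgebra.single_mul_single]
    rw [this, map_mul, hx, hy, map_mul]

theorem lift_mem_part {F : Type u} [Field F] (B : SuperAlg F) {r s : ℕ}
    {v : Fin r ⊕ Fin s → B.carrier} (hv : IsGraded B v) {i : ZMod 2}
    {f : FreeNonUnitalNonAssocAlgebra F (Fin r ⊕ Fin s)} (hf : f ∈ wordPart F r s i) :
    FreeNonUnitalNonAssocAlgebra.lift F v f ∈ B.part i := by
  induction hf using Submodule.span_induction with
  | zero => rw [map_zero]; exact Submodule.zero_mem _
  | add a b _ _ ha hb => rw [map_add]; exact Submodule.add_mem _ ha hb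
  | smul c a _ ha => rw [map_smul]; exact Submodule.smul_mem _ c ha
  | mem a ha =>
    obtain ⟨w, rfl, rfl⟩ := ha
    rw [lift_monomial B.toAlg]
    induction w using FreeMagma.recOnMul with
    | ih1 x =>
      rcases x with x | x
      · have h : parity (FreeMagma.of (Sum.inl x : Fin r ⊕ Fin s)) = 0 := by
          have : letters (FreeMagma.of (Sum.inl x : Fin r ⊕ Fin s)) = {Sum.inl x} := rfl
          rw [parity, this, ← Multiset.cons_zero, Multiset.countP_cons]
          simp
        rw [h]
        exact hv.1 x
      · have h : parity (FreeMagma.of (Sum.inr x : Fin r ⊕ Fin s)) = 1 := by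
          have : letters (FreeMagma.of (Sum.inr x : Fin r ⊕ Fin s)) = {Sum.inr x} := rfl
          rw [parity, this, ← Multiset.cons_zero, Multiset.countP_cons]
          simp
        rw [h]
        exact hv.2 x
    | ih2 x y hx hy =>
      rw [map_mul, parity_mul]
      exact B.mul_mem hx hy

/-- The ideal of all polynomials in `r` even and `s` odd variables that vanish on every
`V`-superalgebra. -/
def superIdentityIdeal {F : Type u} [Field F] (V : Set (Alg F)) (r s : ℕ) :
    AlgIdeal F (FreeNonUnitalNonAssocAlgebra F (Fin r ⊕ Fin s)) where
  toSubmodule :=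
    { carrier := {f | ∀ B ∈ superClass V, ∀ v : Fin r ⊕ Fin s → B.carrier, IsGraded B v →
        FreeNonUnitalNonAssocAlgebra.lift F v f = 0}
      add_mem' := fun hf hg B hB v hv => by
        rw [map_add, hf B hB v hv, hg B hB v hv, add_zero]
      zero_mem' := fun B _ v _ => map_zero _
      smul_mem' := fun c f hf B hB v hv => by rw [map_smul, hf B hB v hv, smul_zero] }
  mul_mem_left a b hb := fun B hB v hv => by rw [map_mul, hb B hB v hv, mul_zero]
  mul_mem_right a b ha := fun B hB v hv => by rw [map_mul, ha B hB v hv, zero_mul]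

theorem exists_parts {F : Type u} [Field F] {r s : ℕ}
    (f : FreeNonUnitalNonAssocAlgebra F (Fin r ⊕ Fin s)) :
    ∃ a ∈ wordPart F r s 0, ∃ b ∈ wordPart F r s 1, a + b = f :=
  Submodule.mem_sup.1 (by rw [(isCompl_wordPart F r s).sup_eq_top]; trivial)

theorem superIdentityIdeal_homogeneous {F : Type u} [Field F] (V : Set (Alg F)) (r s : ℕ)
    {a b : FreeNonUnitalNonAssocAlgebra F (Fin r ⊕ Fin s)} (ha : a ∈ wordPart F r s 0)
    (hb : b ∈ wordPart F r s 1) (h : a - b ∈ (superIdentityIdeal V r s).toSubmodule) :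
    a ∈ (superIdentityIdeal V r s).toSubmodule := by
  intro B hB v hv
  have hab := h B hB v hv
  rw [map_sub, sub_eq_zero] at hab
  have h1 := lift_mem_part B hv hb
  rw [← hab] at h1
  exact Submodule.disjoint_def.1 B.isCompl.disjoint _ (lift_mem_part B hv ha) h1

/-- The free `V`-superalgebra on `r` even and `s` odd generators: the free nonassociative
superalgebra on these generators modulo the ideal of all elements that vanish on every
`V`-superalgebra. -/
def freeSuper {F : Type u} [Field F] (V : Set (Alg F)) (r s : ℕ) : SuperAlg F where
  carrier := (superIdentityIdeal V r s).Quot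
  part i := (wordPart F r s i).map (superIdentityIdeal V r s).proj
  isCompl := by
    constructor
    · rw [Submodule.disjoint_def]
      rintro _ ⟨a, ha, rfl⟩ ⟨b, hb, hab⟩
      rw [AlgIdeal.proj_eq_zero]
      refine superIdentityIdeal_homogeneous V r s ha hb ?_
      rw [← AlgIdeal.proj_eq_zero, map_sub, hab, sub_self]
    · rw [codisjoint_iff, eq_top_iff]
      intro x _
      obtain ⟨f, rfl⟩ := (superIdentityIdeal V r s).proj_surjective x
      obtain ⟨a, ha, b, hb, rfl⟩ := exists_parts f
      rw [map_add]
      exact Submodule.add_mem_sup (Submodule.mem_map_of_mem ha) (Submodule.mem_map_of_mem hb)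
  mul_mem := by
    rintro i j _ _ ⟨a, ha, rfl⟩ ⟨b, hb, rfl⟩
    rw [← AlgIdeal.proj_mul]
    exact Submodule.mem_map_of_mem (wordPart_mul_mem ha hb)

/-! ## Supervarieties and the basic spectrum -/

/-- The supervariety `V_{r,s}` generated by the free `V`-superalgebra on `r` even and `s` odd
generators: all superalgebras satisfying every superidentity of this free superalgebra. -/
def rankSupervariety {F : Type u} [Field F] (V : Set (Alg F)) (r s : ℕ) : Set (SuperAlg F) :=
  {B | ∀ (n : ℕ), ∀ f ∈ multilinear F n, SatisfiesSuper (freeSuper V r s) f → SatisfiesSuper B f}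

/-- The basic spectrum of `V`: the set of all pairs `(r, s)` that are minimal, for the
componentwise order of the lattice of the `V_{r,s}`, with the property that `V_{r,s}` is the class
of all `V`-superalgebras. -/
def basicSpectrum {F : Type u} [Field F] (V : Set (Alg F)) : Set (ℕ × ℕ) :=
  {p | Minimal (fun q : ℕ × ℕ => rankSupervariety V q.1 q.2 = superClass V) p}

/-! ## The variety -/

/-- The variety of metabelian alternative algebras with `x ^ 3 = 0`. -/
def NAlt2 (F : Type u) [Field F] : Set (Alg F) :=
  {A | (∀ x y : A.carrier, x * x * y - x * (x * y) = 0) ∧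
    (∀ x y : A.carrier, x * y * y - x * (y * y) = 0) ∧
    (∀ x y z t : A.carrier, (x * y) * (z * t) = 0) ∧
    (∀ x : A.carrier, x * x * x = 0)}

end

end NilAlt

namespace NilAlt
universe u
variable {F : Type u} [Field F] {C : Alg F}

/-! ## Identities of metabelian alternative nil-algebras -/

/-! Spanning. Let `m` annihilate all products. The linearized alternative laws and the linearization
of x³ = 0 give y(xm) = (mx)y and y(mx) = -(xm)y - (mx)y, and both (mx)y and y(mx) are skew in x, y.
By metabelianity a nonzero word of degree at least two arises from a product of two letters by
multiplying by one letter at a time. So it reduces to operators R…R or LR…R, whose variables may be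
reordered up to sign. Reordering near the core of the word costs only Jordan products a∘b = ab + ba.
Hence the multilinear part of degree n is spanned by two normal words and by R…R, LR…R applied to
Jordan products (`lift_mem_normSpan`). Linearizing x³ = 0 also gives a cyclic identity for (a∘b)c,
which forces a chosen variable into the Jordan product (`jordanSpan_le_rootedSpan`). At most 2n
spanning elements remain.

Independence. A five-dimensional superalgebra with odd generator x detects all of them. Sending
every variable to e_i ⊗ x kills all Jordan products and separates the two normal words. Sending one
variable x_b to 1 ⊗ x² instead leaves x_0∘x_b as the only surviving Jordan product. These
substitutions lift to the free superalgebra on one odd generator, so a multilinear superidentity of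
the latter holds in the whole variety (`eq_zero_of_mem_normSpan`). Conversely, the linearized axioms
are superidentities of every free superalgebra, and in characteristic 0 they imply the axioms. So
(0, 1) generates.

Nilpotency. Among n + 2 letters in n variables some letter repeats, and skew-symmetry, the cyclic
identity and x³ = 0 annihilate the word (`lift_eq_zero`). In degree n + 1 the word x_0x_0 followed
by the other variables survives, with x_0 = e_0 ⊗ x + 1 ⊗ x² in the envelope of the model. This
yields the index and the strict chain. Even generators obey the same bound, so multilinear words of
degree r + 2 are superidentities for (r, 0); the left-normed one fails in the model, which excludes
(r, 0). -/

theorem alt_left (hC : C ∈ NAlt2 F) (x y z : C.carrier) :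
    x * y * z + y * x * z = x * (y * z) + y * (x * z) := by
  have h1 := hC.1 (x + y) z
  have h2 := hC.1 x z
  have h3 := hC.1 y z
  simp only [mul_add, add_mul] at h1
  rw [← sub_eq_zero]
  linear_combination (norm := abel) h1 - h2 - h3

theorem alt_right (hC : C ∈ NAlt2 F) (x y z : C.carrier) :
    x * y * z + x * z * y = x * (y * z) + x * (z * y) := by
  have h1 := hC.2.1 x (y + z)
  have h2 := hC.2.1 x y
  have h3 := hC.2.1 x z
  simp only [mul_add, add_mul] at h1
  rw [← sub_eq_zero]
  linear_combination (norm := abel) h1 - h2 - h3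

theorem metabelian (hC : C ∈ NAlt2 F) (x y z t : C.carrier) : x * y * (z * t) = 0 :=
  hC.2.2.1 x y z t

theorem nil_right (hC : C ∈ NAlt2 F) (x : C.carrier) : x * x * x = 0 := hC.2.2.2 x

theorem nil_left (hC : C ∈ NAlt2 F) (x : C.carrier) : x * (x * x) = 0 := by
  have := hC.1 x x
  rwa [nil_right hC, zero_sub, neg_eq_zero] at this

/-- The Jordan product. -/
def jordan {A : Type*} [Add A] [Mul A] (x y : A) : A := x * y + y * x

theorem jordan_comm {A : Type*} [AddCommMagma A] [Mul A] (x y : A) : jordan x y = jordan y x :=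
  add_comm _ _

theorem jordan_cyclic_right (hC : C ∈ NAlt2 F) (x y z : C.carrier) :
    jordan x y * z + jordan y z * x + jordan z x * y = 0 := by
  have h (a : C.carrier) := nil_right hC a
  have h1 := h (x + y + z)
  have h2 := h (x + y)
  have h3 := h (x + z)
  have h4 := h (y + z)
  simp only [jordan, mul_add, add_mul] at *
  linear_combination (norm := abel) h1 - h2 - h3 - h4 + h x + h y + h z

theorem jordan_cyclic_left (hC : C ∈ NAlt2 F) (x y z : C.carrier) :
    z * jordan x y + x * jordan y z + y * jordan z x = 0 := by
  have h (a : C.carrier) := nil_left hC a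
  have h1 := h (x + y + z)
  have h2 := h (x + y)
  have h3 := h (x + z)
  have h4 := h (y + z)
  simp only [jordan, mul_add, add_mul] at *
  linear_combination (norm := abel) h1 - h2 - h3 - h4 + h x + h y + h z

/-- `m` annihilates all products from both sides. -/
def AnnSq (m : C.carrier) : Prop :=
  ∀ z t : C.carrier, m * (z * t) = 0 ∧ z * t * m = 0

theorem annSq_mul (hC : C ∈ NAlt2 F) (x y : C.carrier) : AnnSq (x * y) :=
  fun z t => ⟨metabelian hC x y z t, metabelian hC z t x y⟩

theorem annSq_jordan (hC : C ∈ NAlt2 F) (x y : C.carrier) : AnnSq (jordan x y) := fun z t => by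
  rw [jordan, add_mul, mul_add, metabelian hC, metabelian hC, metabelian hC, metabelian hC]
  simp

/-- Right alternativity, once the terms m(xy) and m(yx) drop out. -/
theorem right_right (hC : C ∈ NAlt2 F) {m : C.carrier} (hm : AnnSq m) (x y : C.carrier) :
    m * x * y = -(m * y * x) := by
  have h := alt_right hC m x y
  rw [(hm x y).1, (hm y x).1] at h
  linear_combination (norm := abel) h

/-- Alternativity alone suffices: the associators (m,x,y), (x,m,y), (x,y,m) agree up to sign, and
their terms containing the product of x and y vanish. Two left multiplications thus become two right
ones. -/
theorem left_left_eq (hC : C ∈ NAlt2 F) {m : C.carrier} (hm : AnnSq m) (x y : C.carrier) :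
    y * (x * m) = m * x * y := by
  have h1 := alt_left hC m x y
  have h2 := alt_right hC x m y
  have h3 := alt_left hC x y m
  rw [(hm _ _).1] at h1
  rw [(hm _ _).2] at h2
  rw [(hm _ _).2, (hm _ _).2] at h3
  linear_combination (norm := abel) h2 - h1 - h3

/-- Here x³ = 0 enters: in its linearization at x, m, y the purely right multiplications cancel by
`right_right`. -/
theorem left_right (hC : C ∈ NAlt2 F) {m : C.carrier} (hm : AnnSq m) (x y : C.carrier) :
    x * m * y = -(y * m * x) := by
  have h := jordan_cyclic_right hC x m y
  simp only [jordan, add_mul, (hm _ _).2] at h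
  linear_combination (norm := abel) h - right_right hC hm x y

/-- Read as a formula for (xm)y, this moves a left multiplication outwards past a right one. With
`left_left_eq` it leaves only the operator words R…R and LR…R. -/
theorem right_left_eq (hC : C ∈ NAlt2 F) {m : C.carrier} (hm : AnnSq m) (x y : C.carrier) :
    y * (m * x) = -(x * m * y) - m * x * y := by
  have h1 := alt_left hC m y x
  have h2 := right_right hC hm x y
  have h3 := left_right hC hm x y
  rw [(hm _ _).1] at h1
  linear_combination (norm := abel) h2 - h1 + h3

theorem right_left (hC : C ∈ NAlt2 F) {m : C.carrier} (hm : AnnSq m) (x y : C.carrier) :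
    y * (m * x) = -(x * (m * y)) := by
  rw [right_left_eq hC hm, right_left_eq hC hm, left_right hC hm y x, right_right hC hm y x]
  abel

/-! ## Iterated multiplications -/

section Words
variable {A : Type*} [NonUnitalNonAssocRing A] {X : Type*}

/-- Right multiplication of `w` by the variables of a list, the head of the list being the last
factor. -/
def mulR (v : X → A) : List X → A → A
  | [], w => w
  | y :: ys, w => mulR v ys w * v y

/-- As `mulR`, but the last multiplication is on the left. -/
def mulL (v : X → A) : List X → A → A
  -- With no multiplier the left form would repeat the right form; the value zero keeps the spanning
  -- family free of this redundancy.
  | [], _ => 0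
  | y :: ys, w => v y * mulR v ys w

/-- The word with all brackets to the left in the variables of a list, in reverse order. -/
def normR (v : X → A) : List X → A
  | [] => 0
  | [a] => v a
  | y :: z :: ys => normR v (z :: ys) * v y

/-- As `normR`, but the last multiplication is on the left; zero in degree less than three. -/
def normL (v : X → A) : List X → A
  | y :: z :: t :: ys => v y * normR v (z :: t :: ys)
  | _ => 0

theorem mulR_add (v : X → A) (ys : List X) (w w' : A) :
    mulR v ys (w + w') = mulR v ys w + mulR v ys w' := by
  induction ys with
  | nil => rfl
  | cons y ys ih => simp only [mulR, ih, add_mul]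

theorem mulR_zero (v : X → A) (ys : List X) : mulR v ys 0 = 0 := by
  induction ys with
  | nil => rfl
  | cons y ys ih => simp only [mulR, ih, zero_mul]

theorem mulL_zero (v : X → A) (ys : List X) : mulL v ys 0 = 0 := by
  cases ys <;> simp [mulL, mulR_zero]

theorem mulR_neg (v : X → A) (ys : List X) (w : A) : mulR v ys (-w) = -mulR v ys w := by
  rw [eq_neg_iff_add_eq_zero, ← mulR_add, neg_add_cancel, mulR_zero]

theorem mulL_add (v : X → A) (ys : List X) (w w' : A) :
    mulL v ys (w + w') = mulL v ys w + mulL v ys w' := by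
  cases ys <;> simp [mulL, mulR_add, mul_add]

theorem mulL_neg (v : X → A) (ys : List X) (w : A) : mulL v ys (-w) = -mulL v ys w := by
  rw [eq_neg_iff_add_eq_zero, ← mulL_add, neg_add_cancel, mulL_zero]

theorem mulR_smul {R : Type*} [SMul R A] [IsScalarTower R A A] (v : X → A) (ys : List X) (c : R)
    (w : A) : mulR v ys (c • w) = c • mulR v ys w := by
  induction ys with
  | nil => rfl
  | cons y ys ih => simp only [mulR, ih, smul_mul_assoc]

theorem mulL_smul {R : Type*} [MonoidWithZero R] [DistribMulAction R A]
    [IsScalarTower R A A] [SMulCommClass R A A] (v : X → A) (ys : List X) (c : R)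
    (w : A) : mulL v ys (c • w) = c • mulL v ys w := by
  cases ys with
  | nil => simp only [mulL, smul_zero]
  | cons y ys => simp only [mulL, mulR_smul, mul_smul_comm]

theorem mulR_append (v : X → A) (ys : List X) (y : X) (w : A) :
    mulR v (ys ++ [y]) w = mulR v ys (w * v y) := by
  induction ys with
  | nil => rfl
  | cons z ys ih => simp only [List.cons_append, mulR, ih]

theorem mulL_append (v : X → A) {ys : List X} (hys : ys ≠ []) (y : X) (w : A) :
    mulL v (ys ++ [y]) w = mulL v ys (w * v y) := by
  cases ys with
  | nil => exact absurd rfl hys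
  | cons z ys => simp only [List.cons_append, mulL, mulR_append]

theorem normR_append (v : X → A) (ys : List X) (x : X) :
    normR v (ys ++ [x]) = mulR v ys (v x) := by
  induction ys with
  | nil => rfl
  | cons z ys ih => cases ys <;> simp_all [normR, mulR]

variable {B H : Type*} [NonUnitalNonAssocRing B] [FunLike H A B] [NonUnitalRingHomClass H A B] (φ : H)

theorem map_mulR (v : X → A) (ys : List X) (w : A) :
    φ (mulR v ys w) = mulR (φ ∘ v) ys (φ w) := by
  induction ys with
  | nil => rfl
  | cons y ys ih => simp [mulR, ih]

theorem map_mulL (v : X → A) (ys : List X) (w : A) :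
    φ (mulL v ys w) = mulL (φ ∘ v) ys (φ w) := by
  cases ys <;> simp [mulL, map_mulR]

theorem map_normR (v : X → A) (ys : List X) : φ (normR v ys) = normR (φ ∘ v) ys := by
  induction ys with
  | nil => simp [normR]
  | cons y ys ih => cases ys <;> simp_all [normR]

theorem map_normL (v : X → A) (ys : List X) : φ (normL v ys) = normL (φ ∘ v) ys := by
  match ys with
  | [] => simp [normL]
  | [_] => simp [normL]
  | [_, _] => simp [normL]
  | _ :: _ :: _ :: _ => simp [normL, map_normR]

theorem map_jordan (x y : A) : φ (jordan x y) = jordan (φ x) (φ y) := by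
  simp [jordan]

end Words

/-! ### Spanning by normal words -/

section Span
variable {X : Type*} (v : X → C.carrier)

theorem annSq_mulR (hC : C ∈ NAlt2 F) (ys : List X) {w : C.carrier} (hw : AnnSq w) :
    AnnSq (mulR v ys w) := by
  cases ys with
  | nil => exact hw
  | cons y ys => exact annSq_mul hC _ _

theorem annSq_normR (hC : C ∈ NAlt2 F) (y z : X) (ys : List X) :
    AnnSq (normR v (y :: z :: ys)) := annSq_mul hC _ _

/-- Each transposition of neighbours is a sign by `right_right`. Only the existence of some scalar
is needed later. -/
theorem mulR_perm (hC : C ∈ NAlt2 F) {ys zs : List X} (h : ys.Perm zs) {w : C.carrier}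
    (hw : AnnSq w) : ∃ c : F, mulR v ys w = c • mulR v zs w := by
  induction h with
  | nil => exact ⟨1, (one_smul _ _).symm⟩
  | cons y _ ih =>
    obtain ⟨c, hc⟩ := ih
    exact ⟨c, by rw [mulR, hc, smul_mul_assoc, mulR]⟩
  | swap x y ys =>
    refine ⟨-1, ?_⟩
    rw [neg_one_smul]
    exact right_right hC (annSq_mulR v hC ys hw) _ _
  | trans _ _ ih₁ ih₂ =>
    obtain ⟨c, hc⟩ := ih₁
    obtain ⟨d, hd⟩ := ih₂
    exact ⟨c * d, by rw [hc, hd, mul_smul]⟩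

/-- The outer left factor may also be exchanged with the neighbouring right factor, by `right_left`.
-/
theorem mulL_perm (hC : C ∈ NAlt2 F) {ys zs : List X} (h : ys.Perm zs) {w : C.carrier}
    (hw : AnnSq w) : ∃ c : F, mulL v ys w = c • mulL v zs w := by
  induction h with
  | nil => exact ⟨1, (one_smul _ _).symm⟩
  | cons y h _ =>
    obtain ⟨c, hc⟩ := mulR_perm v hC h hw
    exact ⟨c, by rw [mulL, hc, mul_smul_comm, mulL]⟩
  | swap x y ys =>
    refine ⟨-1, ?_⟩
    rw [neg_one_smul]
    exact right_left hC (annSq_mulR v hC ys hw) _ _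
  | trans _ _ ih₁ ih₂ =>
    obtain ⟨c, hc⟩ := ih₁
    obtain ⟨d, hd⟩ := ih₂
    exact ⟨c * d, by rw [hc, hd, mul_smul]⟩

/-- The span of the elements obtained from the Jordan products of two variables by multiplying by
the remaining variables of a multiset. -/
def jordanSpan (s : Multiset X) : Submodule F C.carrier :=
  Submodule.span F {m | ∃ a b : X, ∃ ps : List X, a ::ₘ b ::ₘ (ps : Multiset X) = s ∧
    (m = mulR v ps (jordan (v a) (v b)) ∨ m = mulL v ps (jordan (v a) (v b)))}

theorem mulR_mem_jordanSpan {s : Multiset X} {a b : X} {ps : List X}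
    (h : a ::ₘ b ::ₘ (ps : Multiset X) = s) :
    mulR v ps (jordan (v a) (v b)) ∈ jordanSpan (C := C) v s :=
  Submodule.subset_span ⟨a, b, ps, h, Or.inl rfl⟩

theorem mulL_mem_jordanSpan {s : Multiset X} {a b : X} {ps : List X}
    (h : a ::ₘ b ::ₘ (ps : Multiset X) = s) :
    mulL v ps (jordan (v a) (v b)) ∈ jordanSpan (C := C) v s :=
  Submodule.subset_span ⟨a, b, ps, h, Or.inr rfl⟩

theorem cons_cons_rotate {s : Multiset X} {a b : X} {ps : List X} (y : X)
    (h : a ::ₘ b ::ₘ (ps : Multiset X) = s) :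
    a ::ₘ b ::ₘ ((y :: ps : List X) : Multiset X) = y ::ₘ s := by
  rw [← h, ← Multiset.cons_coe, Multiset.cons_swap b, Multiset.cons_swap a]

/-- The only case to rewrite is LR…R followed by a right multiplication, which `right_left_eq`
returns to the two normal forms. -/
theorem jordanSpan_mul (hC : C ∈ NAlt2 F) {s : Multiset X} {m : C.carrier}
    (hm : m ∈ jordanSpan v s) (y : X) : m * v y ∈ jordanSpan v (y ::ₘ s) := by
  induction hm using Submodule.span_induction with
  | zero => rw [zero_mul]; exact Submodule.zero_mem _
  | add a a' _ _ h h' => rw [add_mul]; exact Submodule.add_mem _ h h'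
  | smul c a _ h => rw [smul_mul_assoc]; exact Submodule.smul_mem _ c h
  | mem m hm =>
    obtain ⟨a, b, ps, h, rfl | rfl⟩ := hm
    · exact mulR_mem_jordanSpan v (cons_cons_rotate y h)
    · have hR := mulR_mem_jordanSpan (C := C) v (cons_cons_rotate y h)
      have hL := mulL_mem_jordanSpan (C := C) v (cons_cons_rotate y h)
      cases ps with
      | nil => simp [mulL]
      | cons z zs =>
        have := right_left_eq hC (annSq_mulR v hC zs (annSq_jordan hC (v a) (v b))) (v z) (v y)
        have h2 : mulL v (z :: zs) (jordan (v a) (v b)) * v y =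
            -mulL v (y :: z :: zs) (jordan (v a) (v b))
              - mulR v (y :: z :: zs) (jordan (v a) (v b)) := by
          simp only [mulL, mulR]
          rw [this]
          abel
        rw [h2]
        exact Submodule.sub_mem _ (Submodule.neg_mem _ hL) hR

theorem mul_jordanSpan (hC : C ∈ NAlt2 F) {s : Multiset X} {m : C.carrier}
    (hm : m ∈ jordanSpan v s) (y : X) : v y * m ∈ jordanSpan v (y ::ₘ s) := by
  induction hm using Submodule.span_induction with
  | zero => rw [mul_zero]; exact Submodule.zero_mem _
  | add a a' _ _ h h' => rw [mul_add]; exact Submodule.add_mem _ h h'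
  | smul c a _ h => rw [mul_smul_comm]; exact Submodule.smul_mem _ c h
  | mem m hm =>
    obtain ⟨a, b, ps, h, rfl | rfl⟩ := hm
    · exact mulL_mem_jordanSpan v (cons_cons_rotate y h)
    · have hR := mulR_mem_jordanSpan (C := C) v (cons_cons_rotate y h)
      cases ps with
      | nil => simp [mulL]
      | cons z zs =>
        rwa [mulL, left_left_eq hC (annSq_mulR v hC zs (annSq_jordan hC (v a) (v b)))]

/-- The span of the normal words in a list of variables. -/
def normSpan (L : List X) : Submodule F C.carrier :=
  Submodule.span F {normR v L, normL v L} ⊔ jordanSpan v L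

theorem normR_mem_normSpan (L : List X) : normR v L ∈ normSpan (C := C) v L :=
  Submodule.mem_sup_left (Submodule.subset_span (by simp))

theorem normL_mem_normSpan (L : List X) : normL v L ∈ normSpan (C := C) v L :=
  Submodule.mem_sup_left (Submodule.subset_span (by simp))

theorem jordanSpan_le_normSpan (L : List X) : jordanSpan v (L : Multiset X) ≤ normSpan (C := C) v L :=
  le_sup_right

theorem normSpan_le {L : List X} {S : Submodule F C.carrier} (hR : normR v L ∈ S)
    (hL : normL v L ∈ S) (hJ : jordanSpan v (L : Multiset X) ≤ S) : normSpan v L ≤ S := by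
  refine sup_le (Submodule.span_le.2 ?_) hJ
  rintro _ (rfl | rfl)
  exacts [hR, hL]

theorem normSpan_mul (hC : C ∈ NAlt2 F) {L : List X} {m : C.carrier}
    (hm : m ∈ normSpan v L) (y : X) : m * v y ∈ normSpan v (y :: L) := by
  suffices h : normSpan v L ≤ (normSpan v (y :: L)).comap ((LinearMap.mul F C.carrier).flip (v y))
    from h hm
  refine normSpan_le v ?_ ?_ fun m hm => jordanSpan_le_normSpan v _ (jordanSpan_mul v hC hm y)
  · change normR v L * v y ∈ normSpan v (y :: L)
    cases L with
    | nil => simp [normR]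
    | cons z zs => exact normR_mem_normSpan v _
  · change normL v L * v y ∈ normSpan v (y :: L)
    match L with
    | [] => simp [normL]
    | [_] => simp [normL]
    | [_, _] => simp [normL]
    | z :: t :: u :: zs =>
      have h2 : normL v (z :: t :: u :: zs) * v y =
          -normL v (y :: z :: t :: u :: zs) - normR v (y :: z :: t :: u :: zs) := by
        simp only [normL, normR]
        rw [right_left_eq hC (annSq_mul hC _ _)]
        abel
      rw [h2]
      exact Submodule.sub_mem _ (Submodule.neg_mem _ (normL_mem_normSpan v _))
        (normR_mem_normSpan v _)

theorem mul_normSpan (hC : C ∈ NAlt2 F) {L : List X} {m : C.carrier}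
    (hm : m ∈ normSpan v L) (y : X) : v y * m ∈ normSpan v (y :: L) := by
  suffices h : normSpan v L ≤ (normSpan v (y :: L)).comap (LinearMap.mul F C.carrier (v y))
    from h hm
  refine normSpan_le v ?_ ?_ fun m hm => jordanSpan_le_normSpan v _ (mul_jordanSpan v hC hm y)
  · change v y * normR v L ∈ normSpan v (y :: L)
    match L with
    | [] => simp [normR]
    | [z] =>
      have h2 : v y * normR v [z] = mulR v [] (jordan (v y) (v z)) - normR v [y, z] := by
        simp [normR, mulR, jordan]
      rw [h2]
      exact Submodule.sub_mem _ (jordanSpan_le_normSpan v _ (mulR_mem_jordanSpan v rfl))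
        (normR_mem_normSpan v _)
    | z :: t :: zs => exact normL_mem_normSpan v (y :: z :: t :: zs)
  · change v y * normL v L ∈ normSpan v (y :: L)
    match L with
    | [] => simp [normL]
    | [_] => simp [normL]
    | [_, _] => simp [normL]
    | z :: t :: u :: zs =>
      rw [normL, left_left_eq hC (annSq_normR v hC _ _ _)]
      exact normR_mem_normSpan v (y :: z :: t :: u :: zs)

/-- In degree three the core `b` is a single variable and need not annihilate products, so the exact
skew-symmetry of `right_right` gets a Jordan correction. The next lemma is the analogue for a left
outer factor. -/
theorem mul_jordan_left (hC : C ∈ NAlt2 F) (x y b : C.carrier) :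
    b * y * x = b * jordan x y - b * x * y := by
  have h := alt_right hC b x y
  simp only [jordan, mul_add]
  linear_combination (norm := abel) h

theorem left_mul_swap (hC : C ∈ NAlt2 F) (x y b : C.carrier) :
    x * (b * y) = jordan x b * y + jordan y b * x - b * jordan x y - y * (b * x) := by
  have h1 := alt_left hC x b y
  have h2 := alt_left hC y b x
  simp only [jordan, add_mul, mul_add]
  linear_combination (norm := abel) - h1 - h2

/-- A transposition is a sign as soon as two letters lie below it, since their product annihilates
all products. Below that degree the correction terms are Jordan words in the same letters. -/
theorem normSpan_perm (hC : C ∈ NAlt2 F) {L L' : List X} (h : L.Perm L') :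
    normSpan (C := C) v L ≤ normSpan v L' := by
  induction h with
  | nil => exact le_rfl
  | @cons y L L' h ih =>
    refine normSpan_le v ?_ ?_ ?_
    · cases L with
      | nil => obtain rfl := List.nil_perm.1 h; exact normR_mem_normSpan v _
      | cons z zs => exact normSpan_mul v hC (ih (normR_mem_normSpan v _)) y
    · match L with
      | [] => simp [normL]
      | [_] => simp [normL]
      | z :: t :: zs => exact mul_normSpan v hC (ih (normR_mem_normSpan v _)) y
    · rw [Multiset.coe_eq_coe.2 (h.cons y)]
      exact jordanSpan_le_normSpan v _
  | swap x y ys =>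
    refine normSpan_le v ?_ ?_ ?_
    · match ys with
      | [] =>
        have h2 : normR v [y, x] = mulR v [] (jordan (v x) (v y)) - normR v [x, y] := by
          simp [normR, mulR, jordan]
        rw [h2]
        exact Submodule.sub_mem _ (jordanSpan_le_normSpan v _ (mulR_mem_jordanSpan v rfl))
          (normR_mem_normSpan v _)
      | [b] =>
        have h2 : normR v [y, x, b] = mulL v [b] (jordan (v y) (v x)) - normR v [x, y, b] :=
          mul_jordan_left hC _ _ _
        rw [h2]
        refine Submodule.sub_mem _ (jordanSpan_le_normSpan v _ (mulL_mem_jordanSpan v ?_))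
          (normR_mem_normSpan v _)
        exact Multiset.cons_swap _ _ _
      | b :: c :: ys =>
        have h2 : normR v (y :: x :: b :: c :: ys) = -normR v (x :: y :: b :: c :: ys) :=
          right_right hC (annSq_normR v hC _ _ _) _ _
        rw [h2]
        exact Submodule.neg_mem _ (normR_mem_normSpan v _)
    · match ys with
      | [] => simp [normL]
      | [b] =>
        have h2 : normL v [y, x, b] = mulR v [x] (jordan (v y) (v b)) +
            mulR v [y] (jordan (v x) (v b)) - mulL v [b] (jordan (v y) (v x))
            - normL v [x, y, b] := left_mul_swap hC _ _ _
        rw [h2]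
        refine Submodule.sub_mem _ (Submodule.sub_mem _ (Submodule.add_mem _
          (jordanSpan_le_normSpan v _ (mulR_mem_jordanSpan v ?_))
          (jordanSpan_le_normSpan v _ (mulR_mem_jordanSpan v ?_)))
          (jordanSpan_le_normSpan v _ (mulL_mem_jordanSpan v ?_))) (normL_mem_normSpan v _)
        · change y ::ₘ b ::ₘ x ::ₘ 0 = x ::ₘ y ::ₘ b ::ₘ 0
          rw [Multiset.cons_swap b, Multiset.cons_swap y]
        · change x ::ₘ b ::ₘ y ::ₘ 0 = x ::ₘ y ::ₘ b ::ₘ 0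
          rw [Multiset.cons_swap b]
        · exact Multiset.cons_swap _ _ _
      | b :: c :: ys =>
        have h2 : normL v (y :: x :: b :: c :: ys) = -normL v (x :: y :: b :: c :: ys) :=
          right_left hC (annSq_normR v hC _ _ _) _ _
        rw [h2]
        exact Submodule.neg_mem _ (normL_mem_normSpan v _)
    · rw [Multiset.coe_eq_coe.2 (List.Perm.swap x y ys)]
      exact jordanSpan_le_normSpan v _
  | trans _ _ ih₁ ih₂ => exact ih₁.trans ih₂

theorem letters_mul (u w : FreeMagma X) : letters (u * w) = letters u + letters w := rfl

theorem letters_of (x : X) : letters (FreeMagma.of x) = {x} := rfl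

/-- If both factors of a word are proper products, metabelianity makes it zero. Otherwise one factor
is a letter, and `normSpan_mul`, `mul_normSpan` apply; `normSpan_perm` then restores the prescribed
order. -/
theorem lift_mem_normSpan (hC : C ∈ NAlt2 F) (w : FreeMagma X) :
    ∀ L : List X, (L : Multiset X) = letters w → FreeMagma.lift v w ∈ normSpan v L := by
  induction w using FreeMagma.recOnMul with
  | ih1 x =>
    intro L hL
    obtain rfl : L = [x] := by
      rw [letters_of] at hL
      exact List.perm_singleton.1 (Multiset.coe_eq_coe.1 hL)
    exact normR_mem_normSpan v [x]
  | ih2 u w hu hw =>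
    intro L hL
    rw [letters_mul] at hL
    rw [map_mul]
    cases u using FreeMagma.recOnMul with
    | ih1 x =>
      have h : (x :: (letters w).toList).Perm L := by
        rw [← Multiset.coe_eq_coe, ← Multiset.cons_coe, Multiset.coe_toList, hL]
        rfl
      exact normSpan_perm v hC h (mul_normSpan v hC (hw _ (Multiset.coe_toList _)) x)
    | ih2 u₁ u₂ =>
      cases w using FreeMagma.recOnMul with
      | ih1 x =>
        have h : (x :: (letters (u₁ * u₂)).toList).Perm L := by
          rw [← Multiset.coe_eq_coe, ← Multiset.cons_coe, Multiset.coe_toList, hL, add_comm]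
          rfl
        exact normSpan_perm v hC h (normSpan_mul v hC (hu _ (Multiset.coe_toList _)) x)
      | ih2 w₁ w₂ =>
        rw [map_mul, map_mul, metabelian hC]
        exact Submodule.zero_mem _

end Span
end NilAlt

namespace NilAlt
universe u
variable {F : Type u} [Field F] {C : Alg F}

/-! ### Jordan words rooted at a fixed variable -/

section Reduction
variable {X : Type*} (v : X → C.carrier)

theorem jordan_mul_rotate (hC : C ∈ NAlt2 F) (x a b : C.carrier) :
    jordan a b * x = -(jordan x b * a + jordan x a * b) := by
  have h := jordan_cyclic_right hC a b x
  rw [jordan_comm b x] at h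
  linear_combination (norm := abel) h

theorem mul_jordan_rotate (hC : C ∈ NAlt2 F) (x a b : C.carrier) :
    x * jordan a b = -(a * jordan x b + b * jordan x a) := by
  have h := jordan_cyclic_left hC a b x
  rw [jordan_comm b x] at h
  linear_combination (norm := abel) h

variable [DecidableEq X]

/-- The elements of `jordanSpan` whose Jordan product involves the variable `x`, with the remaining
variables in a fixed order. -/
def rootedSpan (L : List X) (x : X) : Submodule F C.carrier :=
  ⨆ b : {b // b ∈ L.erase x}, Submodule.span F
    {mulR v ((L.erase x).erase b) (jordan (v x) (v b)),
      mulL v ((L.erase x).erase b) (jordan (v x) (v b))}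

theorem mem_rootedSpan (hC : C ∈ NAlt2 F) {L : List X} {x b : X} {ps : List X}
    (h : (x :: b :: ps).Perm L) :
    mulR v ps (jordan (v x) (v b)) ∈ rootedSpan v L x ∧
      mulL v ps (jordan (v x) (v b)) ∈ rootedSpan v L x := by
  have h1 : (b :: ps).Perm (L.erase x) := by simpa using h.erase x
  have h2 : ps.Perm ((L.erase x).erase b) := by simpa using h1.erase b
  have hb : b ∈ L.erase x := h1.subset List.mem_cons_self
  have hle := le_iSup (fun b : {b // b ∈ L.erase x} => Submodule.span F
    {mulR v ((L.erase x).erase b) (jordan (v x) (v b)),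
      mulL v ((L.erase x).erase b) (jordan (v x) (v b))}) ⟨b, hb⟩
  obtain ⟨c, hc⟩ := mulR_perm v hC h2 (annSq_jordan hC (v x) (v b))
  obtain ⟨d, hd⟩ := mulL_perm v hC h2 (annSq_jordan hC (v x) (v b))
  rw [hc, hd]
  exact ⟨Submodule.smul_mem _ c (hle (Submodule.subset_span (by simp))),
    Submodule.smul_mem _ d (hle (Submodule.subset_span (by simp)))⟩

theorem perm_erase_append {ps : List X} {x : X} (h : x ∈ ps) :
    ps.Perm (ps.erase x ++ [x]) :=
  (List.perm_cons_erase h).trans (List.perm_append_singleton x _).symm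

/-- If `x` is only a multiplier, it can be moved next to the Jordan product up to a scalar, and the
cyclic identity exchanges it with `a` or `b`. -/
theorem jordanSpan_le_rootedSpan (hC : C ∈ NAlt2 F) {L : List X} {x : X} (hx : x ∈ L) :
    jordanSpan v (L : Multiset X) ≤ rootedSpan v L x := by
  refine Submodule.span_le.2 ?_
  rintro m ⟨a, b, ps, h, hm⟩
  have h : (a :: b :: ps).Perm L := Multiset.coe_eq_coe.1 h
  by_cases ha : a = x
  · subst ha
    rcases hm with rfl | rfl
    exacts [(mem_rootedSpan v hC h).1, (mem_rootedSpan v hC h).2]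
  by_cases hb : b = x
  · subst hb
    rw [jordan_comm] at hm
    have h := (List.Perm.swap a b ps).trans h
    rcases hm with rfl | rfl
    exacts [(mem_rootedSpan v hC h).1, (mem_rootedSpan v hC h).2]
  have hp : x ∈ ps := by
    have := h.mem_iff.2 hx
    simpa [Ne.symm ha, Ne.symm hb] using this
  have hperm := perm_erase_append hp
  have hab : (x :: b :: (ps.erase x ++ [a])).Perm L := by
    refine List.Perm.trans ?_ h
    rw [← Multiset.coe_eq_coe]
    have h1 : (ps : Multiset X) = x ::ₘ (ps.erase x : Multiset X) := by
      rw [Multiset.cons_coe, Multiset.coe_eq_coe]; exact List.perm_cons_erase hp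
    simp only [← Multiset.cons_coe, ← Multiset.coe_add, h1, ← Multiset.singleton_add]
    simp only [Multiset.coe_nil, add_zero, Multiset.singleton_add]
    simp only [← Multiset.singleton_add]
    abel
  have hba : (x :: a :: (ps.erase x ++ [b])).Perm L := by
    refine List.Perm.trans ?_ h
    rw [← Multiset.coe_eq_coe]
    have h1 : (ps : Multiset X) = x ::ₘ (ps.erase x : Multiset X) := by
      rw [Multiset.cons_coe, Multiset.coe_eq_coe]; exact List.perm_cons_erase hp
    simp only [← Multiset.cons_coe, ← Multiset.coe_add, h1, ← Multiset.singleton_add]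
    simp only [Multiset.coe_nil, add_zero, Multiset.singleton_add]
    simp only [← Multiset.singleton_add]
    abel
  have hw := annSq_jordan hC (v a) (v b)
  rcases hm with rfl | rfl
  · obtain ⟨c, hc⟩ := mulR_perm v hC hperm hw
    rw [hc, mulR_append, jordan_mul_rotate hC, mulR_neg, mulR_add, ← mulR_append, ← mulR_append]
    exact Submodule.smul_mem _ c (Submodule.neg_mem _ (Submodule.add_mem _
      (mem_rootedSpan v hC hab).1 (mem_rootedSpan v hC hba).1))
  · obtain ⟨c, hc⟩ := mulL_perm v hC hperm hw
    have h1 := (mem_rootedSpan v hC hab).2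
    have h2 := (mem_rootedSpan v hC hba).2
    rw [hc]
    refine Submodule.smul_mem _ c ?_
    -- When `x` is the sole multiplier, it acts on the Jordan product from the left, so the left
    -- cyclic identity is the one needed.
    by_cases hn : ps.erase x = []
    · rw [hn] at h1 h2 ⊢
      simp only [List.nil_append, mulL, mulR] at h1 h2 ⊢
      rw [mul_jordan_rotate hC]
      exact Submodule.neg_mem _ (Submodule.add_mem _ h1 h2)
    · rw [mulL_append v hn] at h1 h2 ⊢
      rw [jordan_mul_rotate hC, mulL_neg, mulL_add]
      exact Submodule.neg_mem _ (Submodule.add_mem _ h1 h2)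

end Reduction

/-! ## Nilpotency -/

section Nilpotency
variable {X : Type*} (v : X → C.carrier)

theorem eq_zero_of_eq_neg [CharZero F] {m : C.carrier} (h : m = -m) : m = 0 := by
  have h2 : (2 : F) • m = 0 := by
    rw [two_smul]
    nth_rewrite 1 [h]
    exact neg_add_cancel m
  exact (smul_eq_zero.1 h2).resolve_left two_ne_zero

variable [CharZero F]

theorem perm_of_not_nodup [DecidableEq X] {ys : List X} (h : ¬ys.Nodup) :
    ∃ x zs, ys.Perm (x :: x :: zs) := by
  obtain ⟨x, hx⟩ := List.exists_duplicate_iff_not_nodup.2 h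
  rw [List.duplicate_iff_two_le_count] at hx
  have h1 : x ∈ ys := List.count_pos_iff.1 (by omega)
  have h2 : x ∈ ys.erase x := List.count_pos_iff.1 (by rw [List.count_erase_self]; omega)
  exact ⟨x, _, (List.perm_cons_erase h1).trans ((List.perm_cons_erase h2).cons x)⟩

theorem mulR_eq_zero [DecidableEq X] (hC : C ∈ NAlt2 F) {ys : List X} (h : ¬ys.Nodup)
    {w : C.carrier} (hw : AnnSq w) : mulR v ys w = 0 := by
  obtain ⟨x, zs, hp⟩ := perm_of_not_nodup h
  obtain ⟨c, hc⟩ := mulR_perm v hC hp hw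
  rw [hc, mulR, mulR, eq_zero_of_eq_neg (right_right hC (annSq_mulR v hC zs hw) (v x) (v x)),
    smul_zero]

theorem mulL_eq_zero [DecidableEq X] (hC : C ∈ NAlt2 F) {ys : List X} (h : ¬ys.Nodup)
    {w : C.carrier} (hw : AnnSq w) : mulL v ys w = 0 := by
  obtain ⟨x, zs, hp⟩ := perm_of_not_nodup h
  obtain ⟨c, hc⟩ := mulL_perm v hC hp hw
  rw [hc, mulL, mulR, eq_zero_of_eq_neg (right_left hC (annSq_mulR v hC zs hw) (v x) (v x)),
    smul_zero]

/-- The cyclic identity at a, b, b. It turns a repetition of `b` across the Jordan product into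
`b`∘`b` and releases `a` as a multiplier. -/
theorem jordan_mul_self (hC : C ∈ NAlt2 F) (a b : C.carrier) :
    jordan a b * b = (-(2⁻¹ : F)) • (jordan b b * a) := by
  have h := jordan_mul_rotate hC b a b
  have h2 : (2 : F) • (jordan a b * b) = -(jordan b b * a) := by
    rw [two_smul]
    rw [jordan_comm b a] at h
    linear_combination (norm := abel) h
  rw [neg_smul, ← smul_neg, ← h2, smul_smul, inv_mul_cancel₀ two_ne_zero, one_smul]

variable [Fintype X] [DecidableEq X]

theorem jordanSpan_eq_bot (hC : C ∈ NAlt2 F) {L : List X} (hL : Fintype.card X + 2 ≤ L.length) :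
    jordanSpan v (L : Multiset X) = ⊥ := by
  rw [jordanSpan, Submodule.span_eq_bot]
  rintro m ⟨a, b, ps, h, hm⟩
  have hlen := (Multiset.coe_eq_coe.1 h : (a :: b :: ps).Perm L).length_eq
  simp only [List.length_cons] at hlen
  have hw := annSq_jordan hC (v a) (v b)
  -- There are at least as many multipliers as variables: either one repeats and skew-symmetry gives
  -- zero, or every variable occurs among them, in particular `b`.
  by_cases hps : ps.Nodup
  · have hall : ∀ x, x ∈ ps := by
      have : ps.toFinset = Finset.univ := by
        rw [← Finset.card_eq_iff_eq_univ, List.toFinset_card_of_nodup hps]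
        have := hps.length_le_card
        omega
      intro x
      rw [← List.mem_toFinset, this]
      exact Finset.mem_univ x
    have hperm := perm_erase_append (hall b)
    by_cases hab : a = b
    · subst hab
      have h1 : jordan (v a) (v a) * v a = 0 := by
        rw [jordan, add_mul, nil_right hC, add_zero]
      have h2 : v a * jordan (v a) (v a) = 0 := by
        rw [jordan, mul_add, nil_left hC, add_zero]
      rcases hm with rfl | rfl
      · obtain ⟨c, hc⟩ := mulR_perm v hC hperm hw
        rw [hc, mulR_append, h1, mulR_zero, smul_zero]
      · obtain ⟨c, hc⟩ := mulL_perm v hC hperm hw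
        rw [hc]
        by_cases hn : ps.erase a = []
        · rw [hn, List.nil_append, mulL, mulR, h2, smul_zero]
        · rw [mulL_append v hn, h1, mulL_zero, smul_zero]
    -- After `jordan_mul_self` is applied at the core, the released `a` meets the copy of `a`
    -- already among the multipliers.
    · have ha : a ∈ ps.erase b := (List.mem_erase_of_ne hab).2 (hall a)
      have hn : ps.erase b ≠ [] := List.ne_nil_of_mem ha
      have hdup : ¬(a :: ps.erase b).Nodup := by simp [ha]
      have hw2 := annSq_jordan hC (v b) (v b)
      have hp2 : (ps.erase b ++ [a]).Perm (a :: ps.erase b) := List.perm_append_singleton a _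
      have hdup' : ¬(ps.erase b ++ [a]).Nodup := fun h => hdup (hp2.nodup_iff.1 h)
      rcases hm with rfl | rfl
      · obtain ⟨c, hc⟩ := mulR_perm v hC hperm hw
        have h3 := mulR_eq_zero v hC hdup' hw2
        rw [mulR_append] at h3
        rw [hc, mulR_append, jordan_mul_self hC, mulR_smul, h3, smul_zero, smul_zero]
      · obtain ⟨c, hc⟩ := mulL_perm v hC hperm hw
        have h3 := mulL_eq_zero v hC hdup' hw2
        rw [mulL_append v hn] at h3
        rw [hc, mulL_append v hn, jordan_mul_self hC, mulL_smul, h3, smul_zero, smul_zero]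
  · rcases hm with rfl | rfl
    exacts [mulR_eq_zero v hC hps hw, mulL_eq_zero v hC hps hw]

theorem normSpan_eq_bot (hC : C ∈ NAlt2 F) {L : List X} (hL : Fintype.card X + 2 ≤ L.length) :
    normSpan (C := C) v L = ⊥ := by
  have hdup : ¬L.Nodup := fun h => by
    have := h.length_le_card
    omega
  obtain ⟨x, ys, hp⟩ := perm_of_not_nodup hdup
  rw [eq_bot_iff]
  refine (normSpan_perm v hC hp).trans ?_
  have hlen := hp.length_eq
  rw [hlen] at hL
  refine normSpan_le v ?_ ?_ (jordanSpan_eq_bot v hC hL).le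
  all_goals rw [Submodule.mem_bot]
  all_goals
    -- The length bound excludes an empty tail. A one-letter tail forces a single variable, so the
    -- word is a cube. In a longer word the two copies of `x` are the outer multipliers, in skew
    -- positions.
    match ys with
    | [] =>
      have := Fintype.card_pos_iff.2 ⟨x⟩
      simp at hL
      omega
    | [b] =>
      have : Fintype.card X ≤ 1 := by simpa using hL
      have : b = x := Fintype.card_le_one_iff.1 this b x
      subst this
      first
        | exact nil_right hC _
        | exact nil_left hC _
    | b :: c :: ys =>
      first
        | exact eq_zero_of_eq_neg (right_right hC (annSq_normR v hC _ _ _) (v x) (v x))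
        | exact eq_zero_of_eq_neg (right_left hC (annSq_normR v hC _ _ _) (v x) (v x))

theorem lift_eq_zero (hC : C ∈ NAlt2 F) (w : FreeMagma X)
    (hw : Fintype.card X + 2 ≤ (letters w).card) : FreeMagma.lift v w = 0 := by
  have h := lift_mem_normSpan v hC w _ (Multiset.coe_toList _)
  rwa [normSpan_eq_bot v hC (by rwa [Multiset.length_toList]), Submodule.mem_bot] at h

end Nilpotency
end NilAlt

namespace NilAlt
universe u

noncomputable section

/-! ## The Grassmann algebra -/

section Grassmann
variable {F : Type u} [Field F]

/-- The generators of the Grassmann algebra. -/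
def Grassmann.gen (F : Type u) [Field F] (i : ℕ) : Grassmann F :=
  ExteriorAlgebra.ι F (Finsupp.single i 1)

theorem Grassmann.gen_mem (i : ℕ) : gen F i ∈ part F 1 :=
  CliffordAlgebra.ι_mem_evenOdd_one _ _

theorem Grassmann.one_mem : (1 : Grassmann F) ∈ part F 0 :=
  Submodule.one_le.1 (CliffordAlgebra.one_le_evenOdd_zero _)

theorem Grassmann.mul_mem {i j : ZMod 2} {a b : Grassmann F} (ha : a ∈ part F i)
    (hb : b ∈ part F j) : a * b ∈ part F (i + j) :=
  CliffordAlgebra.evenOdd_mul_le _ i j (Submodule.mul_mem_mul ha hb)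

theorem Grassmann.ι_mul_even (m : ℕ →₀ F) {a : Grassmann F} (ha : a ∈ part F 0) :
    ExteriorAlgebra.ι F m * a = a * ExteriorAlgebra.ι F m := by
  refine CliffordAlgebra.even_induction (Q := (0 : QuadraticForm F (ℕ →₀ F)))
    (motive := fun a _ => ExteriorAlgebra.ι F m * a = a * ExteriorAlgebra.ι F m) ?_ ?_ ?_ a ha
  · intro r
    exact (Algebra.commutes r _).symm
  · intro x y _ _ hx hy
    rw [mul_add, add_mul, hx, hy]
  · intro m₁ m₂ x _ hx
    have h (m' : ℕ →₀ F) := eq_neg_of_add_eq_zero_left (ExteriorAlgebra.ι_add_mul_swap (R := F) m m')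
    change ExteriorAlgebra.ι F m * (ExteriorAlgebra.ι F m₁ * ExteriorAlgebra.ι F m₂ * x) =
      ExteriorAlgebra.ι F m₁ * ExteriorAlgebra.ι F m₂ * x * ExteriorAlgebra.ι F m
    rw [mul_assoc _ x, ← hx, ← mul_assoc, ← mul_assoc, ← mul_assoc, h m₁, neg_mul, mul_assoc _ _ (ExteriorAlgebra.ι F m₂),
      h m₂]
    simp only [mul_neg, neg_neg, mul_assoc]

theorem Grassmann.odd_mul_even {a b : Grassmann F} (ha : a ∈ part F 1) (hb : b ∈ part F 0) :
    a * b = b * a := by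
  refine CliffordAlgebra.odd_induction (Q := (0 : QuadraticForm F (ℕ →₀ F)))
    (P := fun a _ => a * b = b * a) ?_ ?_ ?_ a ha
  · intro m
    exact ι_mul_even m hb
  · intro x y _ _ hx hy
    rw [mul_add, add_mul, hx, hy]
  · intro m₁ m₂ x _ hx
    change ExteriorAlgebra.ι F m₁ * ExteriorAlgebra.ι F m₂ * x * b =
      b * (ExteriorAlgebra.ι F m₁ * ExteriorAlgebra.ι F m₂ * x)
    rw [mul_assoc, hx, ← mul_assoc, mul_assoc _ _ b, ι_mul_even m₂ hb, ← mul_assoc,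
      ι_mul_even m₁ hb]
    simp only [mul_assoc]

theorem Grassmann.ι_mul_odd (m : ℕ →₀ F) {a : Grassmann F} (ha : a ∈ part F 1) :
    ExteriorAlgebra.ι F m * a = -(a * ExteriorAlgebra.ι F m) := by
  refine CliffordAlgebra.odd_induction (Q := (0 : QuadraticForm F (ℕ →₀ F)))
    (P := fun a _ => ExteriorAlgebra.ι F m * a = -(a * ExteriorAlgebra.ι F m)) ?_ ?_ ?_ a ha
  · intro m'
    exact eq_neg_of_add_eq_zero_left (ExteriorAlgebra.ι_add_mul_swap (R := F) m m')
  · intro x y _ _ hx hy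
    rw [mul_add, add_mul, hx, hy, neg_add]
  · intro m₁ m₂ x _ hx
    have h : ExteriorAlgebra.ι F m₁ * ExteriorAlgebra.ι F m₂ ∈ part F 0 :=
      CliffordAlgebra.ι_mul_ι_mem_evenOdd_zero _ m₁ m₂
    change ExteriorAlgebra.ι F m * (ExteriorAlgebra.ι F m₁ * ExteriorAlgebra.ι F m₂ * x) =
      -(ExteriorAlgebra.ι F m₁ * ExteriorAlgebra.ι F m₂ * x * ExteriorAlgebra.ι F m)
    rw [← mul_assoc, ι_mul_even m h, mul_assoc, hx, mul_neg, mul_assoc _ x]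

theorem Grassmann.odd_mul_odd {a b : Grassmann F} (ha : a ∈ part F 1) (hb : b ∈ part F 1) :
    a * b = -(b * a) := by
  refine CliffordAlgebra.odd_induction (Q := (0 : QuadraticForm F (ℕ →₀ F)))
    (P := fun a _ => a * b = -(b * a)) ?_ ?_ ?_ a ha
  · intro m
    exact ι_mul_odd m hb
  · intro x y _ _ hx hy
    rw [mul_add, add_mul, hx, hy, neg_add]
  · intro m₁ m₂ x _ hx
    have h : ExteriorAlgebra.ι F m₁ * ExteriorAlgebra.ι F m₂ ∈ part F 0 :=
      CliffordAlgebra.ι_mul_ι_mem_evenOdd_zero _ m₁ m₂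
    change ExteriorAlgebra.ι F m₁ * ExteriorAlgebra.ι F m₂ * x * b =
      -(b * (ExteriorAlgebra.ι F m₁ * ExteriorAlgebra.ι F m₂ * x))
    rw [mul_assoc, hx, ← mul_assoc b, odd_mul_even hb h, mul_neg, mul_assoc _ b]

theorem Grassmann.odd_mul_self [CharZero F] {a : Grassmann F} (ha : a ∈ part F 1) : a * a = 0 := by
  have h := odd_mul_odd ha ha
  have h2 : (2 : F) • (a * a) = 0 := by
    rw [two_smul]
    nth_rewrite 1 [h]
    exact neg_add_cancel _
  exact (smul_eq_zero.1 h2).resolve_left two_ne_zero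

/-- The determinant of the coordinates indexed by `L` is an alternating form; its extension to the
exterior algebra maps this product to the determinant of the identity matrix. -/
theorem Grassmann.prod_gen_ne_zero {L : List ℕ} (hL : L.Nodup) : (L.map (gen F)).prod ≠ 0 := by
  have h1 : (L.map (gen F)).prod =
      ExteriorAlgebra.ιMulti F L.length fun i => Finsupp.single (L.get i) (1 : F) := by
    rw [ExteriorAlgebra.ιMulti_apply]
    congr 1
    conv_lhs => rw [← List.ofFn_get L, List.map_ofFn]
    rfl
  let f : (ℕ →₀ F) →ₗ[F] (Fin L.length → F) := LinearMap.pi fun i => Finsupp.lapply (L.get i)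
  let D : (ℕ →₀ F) [⋀^Fin L.length]→ₗ[F] F :=
    (Matrix.detRowAlternating (R := F)).compLinearMap f
  have h2 : ExteriorAlgebra.liftAlternating (R := F) (Pi.single L.length D)
      (L.map (gen F)).prod = 1 := by
    rw [h1, ExteriorAlgebra.liftAlternating_apply_ιMulti, Pi.single_eq_same]
    change Matrix.det (fun i j => (Finsupp.single (L.get i) (1 : F)) (L.get j)) = 1
    have h3 : (fun i j => (Finsupp.single (L.get i) (1 : F)) (L.get j)) =
        (1 : Matrix (Fin L.length) (Fin L.length) F) := by
      ext i j
      rw [Matrix.one_apply, Finsupp.single_apply]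
      simp only [(List.nodup_iff_injective_get.1 hL).eq_iff]
    rw [h3, Matrix.det_one]
  intro h
  rw [h, map_zero] at h2
  exact zero_ne_one h2

end Grassmann

/-! ## A superalgebra of dimension five -/

/-- The five-dimensional superalgebra with an odd element `x`, even elements `e₁ = x²`, `e₂` and
odd elements `f₁`, `f₂`, over a possibly noncommutative ring of scalars. -/
def Model (R : Type*) : Type _ := Fin 5 → R

namespace Model

instance (R : Type*) [Ring R] : AddCommGroup (Model R) :=
  inferInstanceAs (AddCommGroup (Fin 5 → R))

instance (F R : Type*) [Field F] [Ring R] [Algebra F R] : Module F (Model R) :=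
  inferInstanceAs (Module F (Fin 5 → R))

/-- The product of two elements in coordinates. -/
def mul {R : Type*} [Ring R] (a b : Model R) : Model R :=
  -- In the basis x, e₁, e₂, f₁, f₂ the nonzero products are xx = e₁; e₁x = f₂, e₂x = f₁, f₁x = e₂,
  -- f₂x = e₁; xe₁ = f₁, xe₂ = -f₁ - f₂, xf₁ = -e₁, xf₂ = e₁ + e₂.
  ![0, a 0 * b 0 + a 4 * b 0 - a 0 * b 3 + a 0 * b 4, a 3 * b 0 + a 0 * b 4,
    a 2 * b 0 + a 0 * b 1 - a 0 * b 2, a 1 * b 0 - a 0 * b 2]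

theorem add_apply {R : Type*} [Ring R] (a b : Model R) (k : Fin 5) : (a + b) k = a k + b k := rfl

theorem zero_apply {R : Type*} [Ring R] (k : Fin 5) : (0 : Model R) k = 0 := rfl

theorem smul_apply {F R : Type*} [Field F] [Ring R] [Algebra F R] (c : F) (a : Model R)
    (k : Fin 5) : (c • a) k = c • a k := rfl

instance (R : Type*) [Ring R] : NonUnitalNonAssocRing (Model R) where
  mul := mul
  left_distrib a b c := by
    funext k
    change mul a (b + c) k = mul a b k + mul a c k
    fin_cases k <;> simp [mul, add_apply, mul_add] <;> abel
  right_distrib a b c := by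
    funext k
    change mul (a + b) c k = mul a c k + mul b c k
    fin_cases k <;> simp [mul, add_apply, add_mul] <;> abel
  zero_mul a := by
    funext k
    change mul 0 a k = 0
    fin_cases k <;> simp [mul, zero_apply]
  mul_zero a := by
    funext k
    change mul a 0 k = 0
    fin_cases k <;> simp [mul, zero_apply]

theorem mul_def {R : Type*} [Ring R] (a b : Model R) : a * b =
    ![0, a 0 * b 0 + a 4 * b 0 - a 0 * b 3 + a 0 * b 4, a 3 * b 0 + a 0 * b 4,
      a 2 * b 0 + a 0 * b 1 - a 0 * b 2, a 1 * b 0 - a 0 * b 2] := rfl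

section
variable {R : Type*} [Ring R] (a b : Model R)
theorem mul_apply_zero : (a * b) 0 = 0 := rfl
theorem mul_apply_one : (a * b) 1 = a 0 * b 0 + a 4 * b 0 - a 0 * b 3 + a 0 * b 4 := rfl
theorem mul_apply_two : (a * b) 2 = a 3 * b 0 + a 0 * b 4 := rfl
theorem mul_apply_three : (a * b) 3 = a 2 * b 0 + a 0 * b 1 - a 0 * b 2 := rfl
theorem mul_apply_four : (a * b) 4 = a 1 * b 0 - a 0 * b 2 := rfl
end

@[ext]
theorem ext {R : Type*} {a b : Model R} (h0 : a 0 = b 0) (h1 : a 1 = b 1) (h2 : a 2 = b 2) (h3 : a 3 = b 3)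
    (h4 : a 4 = b 4) : a = b := by
  funext k
  fin_cases k <;> assumption

instance (F R : Type*) [Field F] [Ring R] [Algebra F R] :
    IsScalarTower F (Model R) (Model R) where
  smul_assoc c a b := by
    change (c • a) * b = c • (a * b)
    ext <;> simp [mul_apply_zero, mul_apply_one, mul_apply_two, mul_apply_three, mul_apply_four,
      smul_apply, smul_add, smul_sub]

instance (F R : Type*) [Field F] [Ring R] [Algebra F R] :
    SMulCommClass F (Model R) (Model R) where
  smul_comm c a b := by
    change c • (a * b) = a * (c • b)
    ext <;> simp [mul_apply_zero, mul_apply_one, mul_apply_two, mul_apply_three, mul_apply_four,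
      smul_apply, smul_add, smul_sub]

/-- The element with the given coordinates. -/
def mk {R : Type*} (f : Fin 5 → R) : Model R := f

theorem mk_apply {R : Type*} (f : Fin 5 → R) (k : Fin 5) : mk f k = f k := rfl

/-- The parities of the basis elements. -/
def par : Fin 5 → ZMod 2 := ![1, 0, 0, 1, 1]

end Model

section
variable (F : Type u) [Field F]

/-- The five-dimensional superalgebra over the field `F`. -/
def model : SuperAlg F where
  carrier := Model F
  part i :=
    { carrier := {a | ∀ k, Model.par k ≠ i → a k = 0}
      add_mem' := fun ha hb k hk => by rw [Model.add_apply, ha k hk, hb k hk, add_zero]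
      zero_mem' := fun _ _ => rfl
      smul_mem' := fun c a ha k hk => by rw [Model.smul_apply, ha k hk, smul_zero] }
  isCompl := by
    constructor
    · rw [Submodule.disjoint_def]
      intro a h0 h1
      funext k
      by_cases hk : Model.par k = 0
      · exact h1 k (by rw [hk]; decide)
      · exact h0 k hk
    · rw [codisjoint_iff, eq_top_iff]
      intro a _
      refine Submodule.mem_sup.2 ⟨fun k => if Model.par k = 0 then a k else 0, fun k hk => if_neg hk,
        fun k => if Model.par k = 0 then 0 else a k, fun k hk => if_pos ?_, ?_⟩
      · revert hk
        generalize Model.par k = p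
        revert p
        decide
      · funext k
        change (if Model.par k = 0 then (a : Model F) k else 0) +
          (if Model.par k = 0 then 0 else (a : Model F) k) = (a : Model F) k
        split_ifs <;> simp
  mul_mem := by
    intro i j a b ha hb
    have h01 : ∀ p : ZMod 2, p = 0 ∨ p = 1 := by decide
    have ha : ∀ k, Model.par k ≠ i → a k = 0 := ha
    have hb : ∀ k, Model.par k ≠ j → b k = 0 := hb
    have key : ∀ k, Model.par k ≠ i + j → (a * b) k = 0 := by
      intro k hk
      rcases h01 i with rfl | rfl <;> rcases h01 j with rfl | rfl <;>
      fin_cases k <;>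
      simp [Model.par, Fin.forall_fin_succ, show (1 : ZMod 2) + 1 = 0 from rfl] at hk ha hb <;>
      simp [Model.mul_def, ha, hb]
    exact key

variable {F}

/-- The coordinates of the elements of the tensor product of the Grassmann algebra with the
five-dimensional superalgebra, as a linear map. -/
def coordsLinear : Grassmann F ⊗[F] (model F).carrier →ₗ[F] Model (Grassmann F) :=
  (TensorProduct.piScalarRight F F (Grassmann F) (Fin 5)).toLinearMap

/-- No Koszul sign appears: the envelope carries the ordinary tensor product, so the same structure
constants serve with Grassmann coefficients. -/
theorem tmul_mul_tmul_model (g h : Grassmann F) (x y : Model F) :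
    Model.mk (fun k => (x * y) k • (g * h)) =
      Model.mk (fun k => x k • g) * Model.mk (fun k => y k • h) := by
  ext <;>
    simp only [Model.mul_apply_zero, Model.mul_apply_one, Model.mul_apply_two,
      Model.mul_apply_three, Model.mul_apply_four, Model.mk_apply, add_smul, sub_smul,
      smul_mul_smul_comm, zero_smul]

/-- The coordinates of the elements of the tensor product of the Grassmann algebra with the
five-dimensional superalgebra. -/
def coords : Grassmann F ⊗[F] (model F).carrier →ₙₐ[F] Model (Grassmann F) where
  toFun := coordsLinear
  map_smul' := map_smul _
  map_zero' := map_zero _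
  map_add' := map_add _
  map_mul' a b := by
    induction a using TensorProduct.induction_on with
    | zero => rw [zero_mul, map_zero, zero_mul]
    | add a a' h h' => rw [add_mul, map_add, h, h', map_add, add_mul]
    | tmul g x =>
      induction b using TensorProduct.induction_on with
      | zero => rw [mul_zero, map_zero, mul_zero]
      | add a a' h h' => rw [mul_add, map_add, h, h', map_add, mul_add]
      | tmul h y =>
        rw [Algebra.TensorProduct.tmul_mul_tmul]
        exact tmul_mul_tmul_model g h x y

theorem coords_injective : Function.Injective (coords (F := F)) :=
  (TensorProduct.piScalarRight F F (Grassmann F) (Fin 5)).injective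

theorem coords_tmul (g : Grassmann F) (x : (model F).carrier) (k : Fin 5) :
    coords (g ⊗ₜ[F] x) k = (x : Model F) k • g := rfl

theorem coords_mem {a : Grassmann F ⊗[F] (model F).carrier} (ha : a ∈ envelopeSubmodule (model F))
    (k : Fin 5) : coords a k ∈ Grassmann.part F (Model.par k) := by
  induction ha using Submodule.iSup_induction' with
  | zero => rw [map_zero]; exact Submodule.zero_mem _
  | add a a' _ _ h h' => rw [map_add]; exact Submodule.add_mem _ h h'
  | mem i a ha =>
    rw [Submodule.map₂_eq_span_image2] at ha
    induction ha using Submodule.span_induction with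
    | zero => rw [map_zero]; exact Submodule.zero_mem _
    | add a a' _ _ h h' => rw [map_add]; exact Submodule.add_mem _ h h'
    | smul c a _ h =>
      rw [map_smul]
      exact Submodule.smul_mem _ c h
    | mem a ha =>
      obtain ⟨g, hg, x, hx, rfl⟩ := ha
      change coords (g ⊗ₜ[F] x) k ∈ _
      rw [coords_tmul]
      by_cases hk : Model.par k = i
      · rw [hk]
        exact Submodule.smul_mem _ _ hg
      · rw [hx k hk, zero_smul]
        exact Submodule.zero_mem _

/-! ### The axioms in the Grassmann envelope of the model -/

section
variable {R : Type*} [Ring R]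

/-- Every term of a product contains the x-coordinate of one of the factors, and products have no
x-coordinate. -/
theorem Model.mul_mul_mul (a b c d : Model R) : a * b * (c * d) = 0 := by
  ext <;> simp [Model.mul_apply_zero, Model.mul_apply_one, Model.mul_apply_two,
      Model.mul_apply_three, Model.mul_apply_four, Model.zero_apply]

/-- A finite check in coordinates: the parity rules move the odd x-coordinates to the left, where a
repeated one squares to zero, and the remaining terms cancel. -/
theorem Model.graded_identities [CharZero F] {a b : Model (Grassmann F)}
    (ha : ∀ k, a k ∈ Grassmann.part F (Model.par k))
    (hb : ∀ k, b k ∈ Grassmann.part F (Model.par k)) :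
    a * a * b = a * (a * b) ∧ a * b * b = a * (b * b) ∧ a * a * a = 0 := by
  have ha0 : a 0 ∈ Grassmann.part F 1 := ha 0
  have hb0 : b 0 ∈ Grassmann.part F 1 := hb 0
  have sq {s : Grassmann F} (hs : s ∈ Grassmann.part F 1) (c : Grassmann F) :
      s * (s * c) = 0 := by rw [← mul_assoc, Grassmann.odd_mul_self hs, zero_mul]
  have oo {s : Grassmann F} (hs : s ∈ Grassmann.part F 1) {c : Model (Grassmann F)}
      (hc : ∀ k, c k ∈ Grassmann.part F (Model.par k)) {k : Fin 5} (hk : Model.par k = 1) :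
      c k * s = -(s * c k) :=
    Grassmann.odd_mul_odd (hk ▸ hc k) hs
  have oe {s : Grassmann F} (hs : s ∈ Grassmann.part F 1) {c : Model (Grassmann F)}
      (hc : ∀ k, c k ∈ Grassmann.part F (Model.par k)) {k : Fin 5} (hk : Model.par k = 0) :
      c k * s = s * c k :=
    (Grassmann.odd_mul_even hs (hk ▸ hc k)).symm
  have a3 := oo ha0 ha (k := 3) rfl
  have a4 := oo ha0 ha (k := 4) rfl
  have a1 := oe ha0 ha (k := 1) rfl
  have a2 := oe ha0 ha (k := 2) rfl
  have c3 := oo hb0 ha (k := 3) rfl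
  have c4 := oo hb0 ha (k := 4) rfl
  have c1 := oe hb0 ha (k := 1) rfl
  have c2 := oe hb0 ha (k := 2) rfl
  have d3 := oo hb0 hb (k := 3) rfl
  have d4 := oo hb0 hb (k := 4) rfl
  have d1 := oe hb0 hb (k := 1) rfl
  have d2 := oe hb0 hb (k := 2) rfl
  refine ⟨?_, ?_, ?_⟩ <;> ext <;>
    simp only [Model.mul_apply_zero, Model.mul_apply_one, Model.mul_apply_two,
      Model.mul_apply_three, Model.mul_apply_four, Model.zero_apply, mul_add, add_mul, mul_sub,
      sub_mul, mul_assoc, zero_mul, mul_zero, neg_mul, mul_neg, neg_neg, sq ha0, sq hb0,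
      Grassmann.odd_mul_self ha0, Grassmann.odd_mul_self hb0,
      a1, a2, a3, a4, c1, c2, c3, c4, d1, d2, d3, d4] <;>
    abel
end

/-- The inclusion of the Grassmann envelope, in coordinates. -/
def envelopeCoords : (envelope (model F)).carrier →ₙₐ[F] Model (Grassmann F) :=
  coords.comp (NonUnitalSubalgebraClass.subtype (envelopeSubalgebra (model F)))

theorem envelopeCoords_injective : Function.Injective (envelopeCoords (F := F)) :=
  coords_injective.comp Subtype.val_injective

theorem model_mem_superClass [CharZero F] : model F ∈ superClass (NAlt2 F) := by
  have hpar (a : (envelope (model F)).carrier) (k : Fin 5) :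
      envelopeCoords a k ∈ Grassmann.part F (Model.par k) := coords_mem a.2 k
  refine ⟨fun x y => ?_, fun x y => ?_, fun x y z t => ?_, fun x => ?_⟩
  all_goals apply envelopeCoords_injective
  · simp only [map_sub, map_mul, map_zero, sub_eq_zero]
    exact (Model.graded_identities (hpar x) (hpar y)).1
  · simp only [map_sub, map_mul, map_zero, sub_eq_zero]
    exact (Model.graded_identities (hpar x) (hpar y)).2.1
  · simp only [map_mul, map_zero]
    exact Model.mul_mul_mul _ _ _ _
  · simp only [map_mul, map_zero]
    exact (Model.graded_identities (hpar x) (hpar x)).2.2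

end
end
end NilAlt

namespace NilAlt
universe u

noncomputable section

section Evaluation
variable {F : Type u} [Field F]

/-! ## Values of normal words in the five-dimensional superalgebra -/

namespace Model

/-- The odd generator with coefficient `g`. -/
def odd (g : Grassmann F) : Model (Grassmann F) := mk ![g, 0, 0, 0, 0]

/-- The even (`i = 0`) or odd (`i = 1`) element with coordinates `m.1 • γ`, `m.2 • γ`. -/
def vec (i : ZMod 2) (γ : Grassmann F) (m : F × F) : Model (Grassmann F) :=
  if i = 0 then mk ![0, m.1 • γ, m.2 • γ, 0, 0] else mk ![0, 0, 0, m.1 • γ, m.2 • γ]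

/-- Right multiplication by the odd generator. -/
def opR (m : F × F) : F × F := (m.2, m.1)

/-- Left multiplication by the odd generator, up to sign. -/
def opL (m : F × F) : F × F := (m.1 - m.2, -m.2)

theorem odd_mul_odd (g h : Grassmann F) : odd g * odd h = vec 0 (g * h) (1, 0) := by
  rw [vec, if_pos rfl]
  ext <;> simp [mul_apply_zero, mul_apply_one, mul_apply_two, mul_apply_three, mul_apply_four,
    odd, mk_apply]

theorem vec_mul_odd (i : ZMod 2) (γ g : Grassmann F) (m : F × F) :
    vec i γ m * odd g = vec (i + 1) (γ * g) (opR m) := by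
  have h01 : ∀ p : ZMod 2, p = 0 ∨ p = 1 := by decide
  have h2 : (1 : ZMod 2) + 1 = 0 := rfl
  rcases h01 i with rfl | rfl <;> ext <;>
  simp [vec, mul_apply_zero, mul_apply_one, mul_apply_two, mul_apply_three, mul_apply_four,
    odd, mk_apply, opR, h2]

/-- The sign by which left multiplication by x differs from `opL` on odd vectors is compensated by
moving `g` past the odd coefficient. The formula is therefore the same in both parities. -/
theorem odd_mul_vec {i : ZMod 2} {γ g : Grassmann F} (hγ : γ ∈ Grassmann.part F i)
    (hg : g ∈ Grassmann.part F 1) (m : F × F) :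
    odd g * vec i γ m = vec (i + 1) (γ * g) (opL m) := by
  have h01 : ∀ p : ZMod 2, p = 0 ∨ p = 1 := by decide
  have h2 : (1 : ZMod 2) + 1 = 0 := rfl
  rcases h01 i with rfl | rfl
  · ext <;>
    simp [vec, mul_apply_zero, mul_apply_one, mul_apply_two, mul_apply_three, mul_apply_four,
      odd, mk_apply, opL, Grassmann.odd_mul_even hg hγ, sub_smul]
  · ext <;>
    simp [vec, mul_apply_zero, mul_apply_one, mul_apply_two, mul_apply_three, mul_apply_four,
      odd, mk_apply, opL, Grassmann.odd_mul_odd hg hγ, sub_smul, h2]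
    abel

theorem vec_eq_zero {i : ZMod 2} {γ : Grassmann F} {m : F × F} (hγ : γ ≠ 0) (h : vec i γ m = 0) :
    m = 0 := by
  unfold vec at h
  split_ifs at h
  · have h1 : m.1 • γ = 0 := congrFun h 1
    have h2 : m.2 • γ = 0 := congrFun h 2
    exact Prod.ext ((smul_eq_zero.1 h1).resolve_right hγ) ((smul_eq_zero.1 h2).resolve_right hγ)
  · have h1 : m.1 • γ = 0 := congrFun h 3
    have h2 : m.2 • γ = 0 := congrFun h 4
    exact Prod.ext ((smul_eq_zero.1 h1).resolve_right hγ) ((smul_eq_zero.1 h2).resolve_right hγ)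

theorem vec_add (i : ZMod 2) (γ : Grassmann F) (m n : F × F) :
    vec i γ m + vec i γ n = vec i γ (m + n) := by
  unfold vec
  split_ifs <;> ext <;> simp [add_apply, mk_apply, add_smul]

theorem smul_vec (c : F) (i : ZMod 2) (γ : Grassmann F) (m : F × F) :
    c • vec i γ m = vec i γ (c • m) := by
  unfold vec
  split_ifs <;> ext <;> simp [smul_apply, mk_apply, mul_smul]

/-- The nonzero vectors with coordinates `0` and `1`. -/
def IsUnitVec (m : F × F) : Prop := m = (1, 0) ∨ m = (0, 1) ∨ m = (1, 1)

theorem IsUnitVec.ne_zero {m : F × F} (hm : IsUnitVec m) : m ≠ 0 := by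
  rcases hm with rfl | rfl | rfl <;> simp [Prod.ext_iff]

theorem IsUnitVec.opR {m : F × F} (hm : IsUnitVec m) : IsUnitVec (opR m) := by
  rcases hm with rfl | rfl | rfl
  exacts [Or.inr (Or.inl rfl), Or.inl rfl, Or.inr (Or.inr rfl)]

theorem IsUnitVec.iterate {m : F × F} (hm : IsUnitVec m) (k : ℕ) :
    IsUnitVec (Model.opR^[k] m) := by
  induction k with
  | zero => exact hm
  | succ k ih => rw [Function.iterate_succ_apply']; exact ih.opR

/-- For m = (p, q) the determinant of the two images is -(p² - pq + q²). This form may have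
nontrivial zeros over F, but equals -1 on the three vectors (1,0), (0,1), (1,1), which `opR`
permutes. -/
theorem IsUnitVec.independent {m : F × F} (hm : IsUnitVec m) {c d : F}
    (h : c • Model.opR m + d • opL m = 0) : c = 0 ∧ d = 0 := by
  rcases hm with rfl | rfl | rfl <;> simp [Model.opR, opL, Prod.ext_iff] at h <;> grind

/-- The product of the coefficients of a list, in reverse order. -/
def coeffProd {X : Type*} (g : X → Grassmann F) (ys : List X) : Grassmann F :=
  (ys.map g).reverse.prod

theorem coeffProd_cons {X : Type*} (g : X → Grassmann F) (y : X) (ys : List X) :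
    coeffProd g (y :: ys) = coeffProd g ys * g y := by
  simp [coeffProd]

variable {X : Type*} {w : X → Model (Grassmann F)} {g : X → Grassmann F}

theorem mulR_vec {ys : List X} (hg : ∀ y ∈ ys, g y ∈ Grassmann.part F 1)
    (hw : ∀ y ∈ ys, w y = odd (g y)) {i : ZMod 2} {γ : Grassmann F}
    (hγ : γ ∈ Grassmann.part F i) (m : F × F) :
    ∃ j, γ * coeffProd g ys ∈ Grassmann.part F j ∧
      mulR w ys (vec i γ m) = vec j (γ * coeffProd g ys) (opR^[ys.length] m) := by
  induction ys with
  | nil => exact ⟨i, by simpa [coeffProd] using hγ, by simp [mulR, coeffProd]⟩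
  | cons y ys ih =>
    obtain ⟨j, hj, h⟩ := ih (fun z hz => hg z (List.mem_cons_of_mem _ hz))
      (fun z hz => hw z (List.mem_cons_of_mem _ hz))
    refine ⟨j + 1, ?_, ?_⟩
    · rw [coeffProd_cons, ← mul_assoc]
      exact Grassmann.mul_mem hj (hg y List.mem_cons_self)
    · rw [mulR, h, hw y List.mem_cons_self, vec_mul_odd, coeffProd_cons, mul_assoc,
        List.length_cons, Function.iterate_succ_apply']

/-- Both forms have the same parity and the same Grassmann coefficient, so a relation between them
reduces to one between `opR` and `opL` of a single vector. -/
theorem mulL_vec {y : X} {ys : List X} (hg : ∀ z ∈ y :: ys, g z ∈ Grassmann.part F 1)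
    (hw : ∀ z ∈ y :: ys, w z = odd (g z)) {i : ZMod 2} {γ : Grassmann F}
    (hγ : γ ∈ Grassmann.part F i) (m : F × F) :
    ∃ j, mulR w (y :: ys) (vec i γ m) =
        vec j (γ * coeffProd g (y :: ys)) (opR (opR^[ys.length] m)) ∧
      mulL w (y :: ys) (vec i γ m) =
        vec j (γ * coeffProd g (y :: ys)) (opL (opR^[ys.length] m)) := by
  obtain ⟨j, hj, h⟩ := mulR_vec (fun z hz => hg z (List.mem_cons_of_mem _ hz))
      (fun z hz => hw z (List.mem_cons_of_mem _ hz)) hγ m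
  refine ⟨j + 1, ?_, ?_⟩
  · rw [mulR, h, hw y List.mem_cons_self, vec_mul_odd, coeffProd_cons, mul_assoc]
  · rw [mulL, h, hw y List.mem_cons_self, odd_mul_vec hj (hg y List.mem_cons_self),
      coeffProd_cons, mul_assoc]

theorem normR_eq {y z : X} {ys : List X} (hg : ∀ t ∈ y :: z :: ys, g t ∈ Grassmann.part F 1)
    (hw : ∀ t ∈ y :: z :: ys, w t = odd (g t)) :
    ∃ j, coeffProd g (y :: z :: ys) ∈ Grassmann.part F j ∧
      normR w (y :: z :: ys) = vec j (coeffProd g (y :: z :: ys)) (opR^[ys.length] (1, 0)) := by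
  induction ys generalizing y z with
  | nil =>
    refine ⟨0, ?_, ?_⟩
    · have h := Grassmann.mul_mem (hg z (by simp)) (hg y (by simp))
      have h2 : coeffProd g [y, z] = g z * g y := by simp [coeffProd]
      rw [h2]
      rwa [show (1 : ZMod 2) + 1 = 0 from rfl] at h
    · simp [normR, hw, odd_mul_odd, coeffProd]
  | cons t ys ih =>
    obtain ⟨j, hj, h⟩ := ih (y := z) (z := t) (fun s hs => hg s (List.mem_cons_of_mem _ hs))
      (fun s hs => hw s (List.mem_cons_of_mem _ hs))
    refine ⟨j + 1, ?_, ?_⟩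
    · rw [coeffProd_cons]
      exact Grassmann.mul_mem hj (hg y List.mem_cons_self)
    · rw [normR, h, hw y List.mem_cons_self, vec_mul_odd, coeffProd_cons g y,
        List.length_cons, Function.iterate_succ_apply']

theorem normL_eq {y z t : X} {ys : List X} (hg : ∀ s ∈ y :: z :: t :: ys, g s ∈ Grassmann.part F 1)
    (hw : ∀ s ∈ y :: z :: t :: ys, w s = odd (g s)) :
    ∃ j, normR w (y :: z :: t :: ys) =
        vec j (coeffProd g (y :: z :: t :: ys)) (opR (opR^[ys.length] (1, 0))) ∧
      normL w (y :: z :: t :: ys) =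
        vec j (coeffProd g (y :: z :: t :: ys)) (opL (opR^[ys.length] (1, 0))) := by
  obtain ⟨j, hj, h⟩ := normR_eq (fun s hs => hg s (List.mem_cons_of_mem _ hs))
      (fun s hs => hw s (List.mem_cons_of_mem _ hs))
  refine ⟨j + 1, ?_, ?_⟩
  · rw [normR, h, hw y List.mem_cons_self, vec_mul_odd, coeffProd_cons g y]
  · rw [normL, h, hw y List.mem_cons_self, odd_mul_vec hj (hg y List.mem_cons_self),
      coeffProd_cons g y]

theorem coeffProd_gen_ne_zero {n : ℕ} {ys : List (Fin n)} (h : ys.Nodup) :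
    coeffProd (fun i : Fin n => Grassmann.gen F i) ys ≠ 0 := by
  have : (ys.map fun i : Fin n => Grassmann.gen F i).reverse =
      ((ys.map Fin.val).reverse.map (Grassmann.gen F)) := by
    simp [List.map_reverse, Function.comp_def]
  rw [coeffProd, this]
  exact Grassmann.prod_gen_ne_zero (List.nodup_reverse.2 (h.map Fin.val_injective))

theorem gen_mul_coeffProd_ne_zero {n : ℕ} {x : Fin n} {ys : List (Fin n)} (h : (x :: ys).Nodup) :
    Grassmann.gen F x * coeffProd (fun i : Fin n => Grassmann.gen F i) ys ≠ 0 := by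
  have h2 : (ys ++ [x]).Nodup := (List.perm_append_singleton x ys).nodup_iff.2 h
  have := coeffProd_gen_ne_zero (F := F) h2
  simpa [coeffProd] using this

end Model
end Evaluation

/-! ## Homomorphisms -/

section Hom
variable {F : Type u} [Field F]

/-- The canonical projection onto a quotient, as a homomorphism. -/
def AlgIdeal.projHom {A : Type u} [NonUnitalNonAssocRing A] [Module F A] [IsScalarTower F A A]
    [SMulCommClass F A A] (I : AlgIdeal F A) : A →ₙₐ[F] I.Quot where
  toFun := I.proj
  map_smul' := map_smul _
  map_zero' := map_zero _
  map_add' := map_add _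
  map_mul' := I.proj_mul

/-- The homomorphism from a quotient induced by a homomorphism vanishing on the ideal. -/
def AlgIdeal.liftHom {A B : Type u} [NonUnitalNonAssocRing A] [Module F A] [IsScalarTower F A A]
    [SMulCommClass F A A] [NonUnitalNonAssocRing B] [Module F B] (I : AlgIdeal F A)
    (φ : A →ₙₐ[F] B) (h : ∀ a ∈ I.toSubmodule, φ a = 0) : I.Quot →ₙₐ[F] B where
  toFun := I.toSubmodule.liftQ (φ : A →ₗ[F] B) h
  map_smul' := map_smul _
  map_zero' := map_zero _
  map_add' := map_add _
  map_mul' a b := by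
    obtain ⟨a, rfl⟩ := I.proj_surjective a
    obtain ⟨b, rfl⟩ := I.proj_surjective b
    rw [← AlgIdeal.proj_mul]
    exact map_mul φ a b

theorem map_lift {X A B : Type*} [NonUnitalNonAssocRing A] [Module F A] [IsScalarTower F A A]
    [SMulCommClass F A A] [NonUnitalNonAssocRing B] [Module F B] [IsScalarTower F B B]
    [SMulCommClass F B B] (φ : A →ₙₐ[F] B) (v : X → A) (f : FreeNonUnitalNonAssocAlgebra F X) :
    φ (FreeNonUnitalNonAssocAlgebra.lift F v f) =
      FreeNonUnitalNonAssocAlgebra.lift F (φ ∘ v) f := by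
  have : φ.comp (FreeNonUnitalNonAssocAlgebra.lift F v) =
      FreeNonUnitalNonAssocAlgebra.lift F (φ ∘ v) := by
    apply FreeNonUnitalNonAssocAlgebra.hom_ext
    intro x
    simp
  rw [← this]
  rfl

/-- The homomorphism of tensor products with the Grassmann algebra. -/
def tensorHom {A B : Alg F} (φ : A.carrier →ₙₐ[F] B.carrier) :
    Grassmann F ⊗[F] A.carrier →ₙₐ[F] Grassmann F ⊗[F] B.carrier where
  toFun := LinearMap.lTensor (Grassmann F) (φ : A.carrier →ₗ[F] B.carrier)
  map_smul' := map_smul _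
  map_zero' := map_zero _
  map_add' := map_add _
  map_mul' a b := by
    induction a using TensorProduct.induction_on with
    | zero => rw [zero_mul, map_zero, zero_mul]
    | add a a' h h' => rw [add_mul, map_add, h, h', map_add, add_mul]
    | tmul g x =>
      induction b using TensorProduct.induction_on with
      | zero => rw [mul_zero, map_zero, mul_zero]
      | add a a' h h' => rw [mul_add, map_add, h, h', map_add, mul_add]
      | tmul h y =>
        rw [Algebra.TensorProduct.tmul_mul_tmul, LinearMap.lTensor_tmul, LinearMap.lTensor_tmul,
          LinearMap.lTensor_tmul, Algebra.TensorProduct.tmul_mul_tmul]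
        congr 1
        exact map_mul φ x y

theorem tensorHom_tmul {A B : Alg F} (φ : A.carrier →ₙₐ[F] B.carrier) (g : Grassmann F)
    (a : A.carrier) : tensorHom φ (g ⊗ₜ[F] a) = g ⊗ₜ[F] φ a := rfl

theorem tensorHom_mem {A B : SuperAlg F} (φ : A.carrier →ₙₐ[F] B.carrier)
    (hφ : ∀ i, ∀ a ∈ A.part i, φ a ∈ B.part i) {a : Grassmann F ⊗[F] A.carrier}
    (ha : a ∈ envelopeSubmodule A) :
    tensorHom (A := A.toAlg) (B := B.toAlg) φ a ∈ envelopeSubmodule B := by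
  induction ha using Submodule.iSup_induction' with
  | zero => rw [map_zero]; exact Submodule.zero_mem _
  | add a a' _ _ h h' => rw [map_add]; exact Submodule.add_mem _ h h'
  | mem i a ha =>
    rw [Submodule.map₂_eq_span_image2] at ha
    induction ha using Submodule.span_induction with
    | zero => rw [map_zero]; exact Submodule.zero_mem _
    | add a a' _ _ h h' => rw [map_add]; exact Submodule.add_mem _ h h'
    | smul c a _ h => rw [map_smul]; exact Submodule.smul_mem _ c h
    | mem a ha =>
      obtain ⟨g, hg, x, hx, rfl⟩ := ha
      exact Submodule.mem_iSup_of_mem i (Submodule.apply_mem_map₂ _ hg (hφ i x hx))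

theorem tmul_mem_envelope {A : SuperAlg F} {i : ZMod 2} {g : Grassmann F} {a : A.carrier}
    (hg : g ∈ Grassmann.part F i) (ha : a ∈ A.part i) : g ⊗ₜ[F] a ∈ envelopeSubmodule A :=
  Submodule.mem_iSup_of_mem i (Submodule.apply_mem_map₂ _ hg ha)

/-- The homomorphism of Grassmann envelopes induced by a homomorphism of superalgebras. -/
def envelopeMap {A B : SuperAlg F} (φ : A.carrier →ₙₐ[F] B.carrier)
    (hφ : ∀ i, ∀ a ∈ A.part i, φ a ∈ B.part i) :
    (envelope A).carrier →ₙₐ[F] (envelope B).carrier where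
  toFun a := ⟨tensorHom (A := A.toAlg) (B := B.toAlg) φ a.1, tensorHom_mem φ hφ a.2⟩
  map_smul' c a := Subtype.ext (map_smul _ c a.1)
  map_zero' := Subtype.ext (map_zero _)
  map_add' a b := Subtype.ext (map_add _ a.1 b.1)
  map_mul' a b := Subtype.ext (map_mul _ a.1 b.1)

end Hom
end
end NilAlt

namespace NilAlt
universe u

noncomputable section

variable {F : Type u} [Field F]

/-! ## The degree filtration of a relatively free algebra -/

section Filtration
variable {X : Type} (I : AlgIdeal F (FreeNonUnitalNonAssocAlgebra F X))

theorem monomial_mul (u w : FreeMagma X) : monomial F (u * w) = monomial F u * monomial F w := by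
  simp [monomial, MonoidAlgebra.single_mul_single]

theorem one_le_card_letters {Y : Type*} (w : FreeMagma Y) : 1 ≤ (letters w).card := by
  induction w using FreeMagma.recOnMul with
  | ih1 x => rw [letters_of, Multiset.card_singleton]
  | ih2 u w hu hw => rw [letters_mul, Multiset.card_add]; omega

/-- The span of the monomials of degree at least `m`. -/
def degreeSpan (m : ℕ) : Submodule F I.Quot :=
  Submodule.span F {a | ∃ w : FreeMagma X, m ≤ (letters w).card ∧ a = I.proj (monomial F w)}

theorem degreeSpan_one : degreeSpan I 1 = ⊤ := by
  rw [eq_top_iff]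
  intro x _
  obtain ⟨f, rfl⟩ := I.proj_surjective x
  induction f using MonoidAlgebra.induction_linear with
  | zero => rw [map_zero]; exact Submodule.zero_mem _
  | add f g hf hg => rw [map_add]; exact Submodule.add_mem _ (hf trivial) (hg trivial)
  | single w c =>
    have h : (MonoidAlgebra.single w c : FreeNonUnitalNonAssocAlgebra F X)
        = c • monomial F w := by simp [monomial]
    rw [h, map_smul]
    exact Submodule.smul_mem _ c (Submodule.subset_span ⟨w, one_le_card_letters w, rfl⟩)

theorem degreeSpan_mul {m k : ℕ} {a b : I.Quot} (ha : a ∈ degreeSpan I m)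
    (hb : b ∈ degreeSpan I k) : a * b ∈ degreeSpan I (m + k) := by
  induction ha using Submodule.span_induction with
  | zero => rw [zero_mul]; exact Submodule.zero_mem _
  | add a a' _ _ h h' => rw [add_mul]; exact Submodule.add_mem _ h h'
  | smul c a _ h => rw [smul_mul_assoc]; exact Submodule.smul_mem _ c h
  | mem a ha =>
    obtain ⟨u, hu, rfl⟩ := ha
    induction hb using Submodule.span_induction with
    | zero => rw [mul_zero]; exact Submodule.zero_mem _
    | add b b' _ _ h h' => rw [mul_add]; exact Submodule.add_mem _ h h'
    | smul c b _ h => rw [mul_smul_comm]; exact Submodule.smul_mem _ c h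
    | mem b hb =>
      obtain ⟨w, hw, rfl⟩ := hb
      refine Submodule.subset_span ⟨u * w, ?_, ?_⟩
      · rw [letters_mul, Multiset.card_add]
        omega
      · rw [monomial_mul, AlgIdeal.proj_mul]

/-- Every element lies in filtration degree one and the filtration is multiplicative. Vanishing of
long words in the generators therefore passes to long words in arbitrary elements. -/
theorem lift_mem_degreeSpan {Y : Type*} (v : Y → I.Quot) (w : FreeMagma Y) :
    FreeMagma.lift v w ∈ degreeSpan I (letters w).card := by
  induction w using FreeMagma.recOnMul with
  | ih1 x =>
    rw [letters_of, Multiset.card_singleton, degreeSpan_one]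
    trivial
  | ih2 u w hu hw =>
    rw [map_mul, letters_mul, Multiset.card_add]
    exact degreeSpan_mul I hu hw

end Filtration

/-! ## Left-normed words -/

section LeftNormed
variable {X : Type*}

/-- The word with all brackets to the left in the variables of a list, in reverse order, starting
with `x`. -/
def leftNormed (x : X) : List X → FreeMagma X
  | [] => FreeMagma.of x
  | y :: ys => leftNormed x ys * FreeMagma.of y

theorem letters_leftNormed (x : X) (ys : List X) :
    letters (leftNormed x ys) = x ::ₘ (ys : Multiset X) := by
  induction ys with
  | nil => rfl
  | cons y ys ih =>
    rw [leftNormed, letters_mul, ih, letters_of, add_comm, Multiset.singleton_add,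
      Multiset.cons_swap, Multiset.cons_coe]

theorem lift_leftNormed {A : Type*} [NonUnitalNonAssocRing A] (v : X → A) (x : X) (ys : List X) :
    FreeMagma.lift v (leftNormed x ys) = mulR v ys (v x) := by
  induction ys with
  | nil => rfl
  | cons y ys ih => rw [leftNormed, map_mul, ih, FreeMagma.lift_of, mulR]

end LeftNormed

/-! ## Relatively free algebras -/

theorem freeAlg_mem (n : ℕ) : freeAlg (NAlt2 F) n ∈ NAlt2 F := by
  let I := identityIdeal (NAlt2 F) (Fin n)
  have key (f : FreeNonUnitalNonAssocAlgebra F (Fin n))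
      (h : ∀ A ∈ NAlt2 F, Satisfies A f) : I.projHom f = 0 :=
    (I.proj_eq_zero f).2 h
  refine ⟨fun x y => ?_, fun x y => ?_, fun x y z t => ?_, fun x => ?_⟩
  · obtain ⟨x, rfl⟩ := I.proj_surjective x
    obtain ⟨y, rfl⟩ := I.proj_surjective y
    refine key (x * x * y - x * (x * y)) fun A hA v => ?_
    simp only [map_sub, map_mul]
    exact hA.1 _ _
  · obtain ⟨x, rfl⟩ := I.proj_surjective x
    obtain ⟨y, rfl⟩ := I.proj_surjective y
    refine key (x * y * y - x * (y * y)) fun A hA v => ?_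
    simp only [map_sub, map_mul]
    exact hA.2.1 _ _
  · obtain ⟨x, rfl⟩ := I.proj_surjective x
    obtain ⟨y, rfl⟩ := I.proj_surjective y
    obtain ⟨z, rfl⟩ := I.proj_surjective z
    obtain ⟨t, rfl⟩ := I.proj_surjective t
    refine key (x * y * (z * t)) fun A hA v => ?_
    simp only [map_mul]
    exact hA.2.2.1 _ _ _ _
  · obtain ⟨x, rfl⟩ := I.proj_surjective x
    refine key (x * x * x) fun A hA v => ?_
    simp only [map_mul]
    exact hA.2.2.2 _

/-! ### Vanishing and nonvanishing in the relatively free algebras -/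

variable [CharZero F]

theorem degreeSpan_eq_bot (n : ℕ) :
    degreeSpan (identityIdeal (NAlt2 F) (Fin n)) (n + 2) = ⊥ := by
  rw [degreeSpan, Submodule.span_eq_bot]
  rintro _ ⟨w, hw, rfl⟩
  rw [AlgIdeal.proj_eq_zero]
  intro A hA v
  rw [lift_monomial]
  exact lift_eq_zero v hA w (by rwa [Fintype.card_fin])

/-- The basis vectors of the five-dimensional superalgebra. -/
def unitVec (F : Type u) [Field F] (k : Fin 5) : (model F).carrier := Model.mk (Pi.single k 1)

omit [CharZero F] in
theorem unitVec_mem (k : Fin 5) : unitVec F k ∈ (model F).part (Model.par k) := by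
  intro l hl
  exact Pi.single_eq_of_ne (fun h => hl (by rw [h])) _

/-- The odd element of the superalgebra multiplied by a generator of the Grassmann algebra. -/
def envelopeOdd (F : Type u) [Field F] (i : ℕ) : (envelope (model F)).carrier :=
  ⟨Grassmann.gen F i ⊗ₜ[F] unitVec F 0, tmul_mem_envelope (Grassmann.gen_mem i) (unitVec_mem 0)⟩

/-- The square of the odd element of the superalgebra as an element of the envelope. -/
def envelopeEven (F : Type u) [Field F] : (envelope (model F)).carrier :=
  ⟨1 ⊗ₜ[F] unitVec F 1, tmul_mem_envelope Grassmann.one_mem (unitVec_mem 1)⟩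

omit [CharZero F] in
theorem envelopeCoords_odd (i : ℕ) :
    envelopeCoords (envelopeOdd F i) = Model.odd (Grassmann.gen F i) := by
  change (fun k => (Pi.single 0 1 : Fin 5 → F) k • Grassmann.gen F i : Fin 5 → Grassmann F) = _
  funext k
  fin_cases k <;> simp [Model.odd, Model.mk]

omit [CharZero F] in
theorem envelopeCoords_even :
    envelopeCoords (envelopeEven F) = Model.vec 0 1 (1, 0) := by
  change (fun k => (Pi.single 1 1 : Fin 5 → F) k • (1 : Grassmann F) : Fin 5 → Grassmann F) = _
  funext k
  fin_cases k <;> simp [Model.vec, Model.mk]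

/-- Values of the variables with a nonzero left-normed product of maximal degree. -/
def witness {n : ℕ} (i : Fin n) : (envelope (model F)).carrier :=
  if (i : ℕ) = 0 then envelopeOdd F 0 + envelopeEven F else envelopeOdd F i

theorem mulR_witness_ne_zero {n : ℕ} {x : Fin n} (hx : (x : ℕ) = 0) {ys : List (Fin n)}
    (h : (x :: ys).Nodup) :
    mulR (witness (F := F)) ys (witness x * witness x) ≠ 0 := by
  intro h0
  have h1 := congrArg envelopeCoords h0
  -- Squaring e_0 ⊗ x + 1 ⊗ x² leaves only the cross terms e_0 ⊗ (x·x² + x²·x), since e_0² = 0 and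
  -- x²x² = 0. This permits the first variable to occur twice.
  have h2 : envelopeCoords (witness (F := F) x) * envelopeCoords (witness (F := F) x) =
      Model.vec 1 (Grassmann.gen F x) (1, 1) := by
    rw [witness, if_pos hx, hx, map_add, envelopeCoords_odd, envelopeCoords_even]
    ext <;> simp [Model.odd, Model.add_apply, Model.mul_apply_zero, Model.mul_apply_one, Model.mul_apply_two,
      Model.mul_apply_three, Model.mul_apply_four, Model.mk_apply, Model.vec,
      Grassmann.odd_mul_self (Grassmann.gen_mem 0)]
  obtain ⟨j, -, h3⟩ := Model.mulR_vec (ys := ys) (w := envelopeCoords ∘ witness (F := F))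
    (g := fun i : Fin n => Grassmann.gen F i) (fun y _ => Grassmann.gen_mem _)
    (fun y hy => by
      have hy0 : (y : ℕ) ≠ 0 := fun hy0 => (List.nodup_cons.1 h).1
        (by rwa [← Fin.ext (hy0.trans hx.symm)])
      rw [Function.comp_apply, witness, if_neg hy0, envelopeCoords_odd]) (Grassmann.gen_mem (x : ℕ)) (1, 1)
  rw [map_mulR, map_mul, h2, h3, map_zero] at h1
  exact (Model.IsUnitVec.iterate (Or.inr (Or.inr rfl)) _).ne_zero
    (Model.vec_eq_zero (Model.gen_mul_coeffProd_ne_zero h) h1)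

theorem lift_eq_zero_of_freeAlg {n : ℕ} {Y : Type*} (v : Y → (freeAlg (NAlt2 F) n).carrier)
    (w : FreeMagma Y) (hw : n + 2 ≤ (letters w).card) : FreeMagma.lift v w = 0 := by
  have h : FreeMagma.lift v w ∈ degreeSpan _ (letters w).card :=
    lift_mem_degreeSpan (identityIdeal (NAlt2 F) (Fin n)) v w
  have h2 : degreeSpan (identityIdeal (NAlt2 F) (Fin n)) (letters w).card ≤
      degreeSpan _ (n + 2) := by
    refine Submodule.span_mono ?_
    rintro _ ⟨u, hu, rfl⟩
    exact ⟨u, hw.trans hu, rfl⟩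
  have h3 := h2 h
  rw [degreeSpan_eq_bot] at h3
  exact (Submodule.mem_bot F).1 h3

theorem power_freeAlg_eq_bot (n : ℕ) : power (freeAlg (NAlt2 F) n) (n + 2) = ⊥ := by
  rw [power, Submodule.span_eq_bot]
  rintro _ ⟨w, hw, rfl⟩
  exact lift_eq_zero_of_freeAlg id w hw.ge

/-- The generators of a relatively free algebra. -/
def freeGen (F : Type u) [Field F] (n : ℕ) (i : Fin n) : (freeAlg (NAlt2 F) n).carrier :=
  (identityIdeal (NAlt2 F) (Fin n)).projHom (FreeNonUnitalNonAssocAlgebra.of F i)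

omit [CharZero F] in
theorem lift_projHom {n : ℕ} (f : FreeNonUnitalNonAssocAlgebra F (Fin n)) :
    FreeNonUnitalNonAssocAlgebra.lift F (freeGen F n) f =
      (identityIdeal (NAlt2 F) (Fin n)).projHom f := by
  change FreeNonUnitalNonAssocAlgebra.lift F
    ((identityIdeal (NAlt2 F) (Fin n)).projHom ∘ FreeNonUnitalNonAssocAlgebra.of F) f = _
  rw [FreeNonUnitalNonAssocAlgebra.lift_comp_of]

omit [CharZero F] in
theorem lift_freeGen_eq_zero {n : ℕ} {w : FreeMagma (Fin n)}
    (h : FreeMagma.lift (freeGen F n) w = 0) {A : Alg F} (hA : A ∈ NAlt2 F)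
    (v : Fin n → A.carrier) : FreeMagma.lift v w = 0 := by
  rw [← lift_monomial, lift_projHom] at h
  rw [← lift_monomial]
  exact ((identityIdeal (NAlt2 F) (Fin n)).proj_eq_zero _).1 h A hA v

/-- The list of all variables but the first. -/
def tailVars (n : ℕ) : List (Fin (n + 1)) := (List.finRange n).map Fin.succ

omit [CharZero F] in
theorem nodup_cons_tailVars (n : ℕ) : (0 :: tailVars n).Nodup := by
  rw [tailVars, ← List.finRange_succ]
  exact List.nodup_finRange _

theorem mulR_freeGen_ne_zero {n : ℕ} {ys : List (Fin (n + 1))} (h : (0 :: ys).Nodup) :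
    mulR (freeGen F (n + 1)) (ys ++ [0]) (freeGen F (n + 1) 0) ≠ 0 := by
  intro h0
  rw [← lift_leftNormed] at h0
  have h1 := lift_freeGen_eq_zero h0 (A := envelope (model F)) model_mem_superClass witness
  rw [lift_leftNormed, mulR_append] at h1
  exact mulR_witness_ne_zero rfl h h1

theorem mulR_map {X Y A : Type*} [NonUnitalNonAssocRing A] (v : Y → A) (j : X → Y) (ys : List X)
    (w : A) : mulR v (ys.map j) w = mulR (v ∘ j) ys w := by
  induction ys with
  | nil => rfl
  | cons y ys ih => simp [mulR, ih]

theorem isNilpotencyIndex_freeAlg {n : ℕ} (hn : 1 ≤ n) :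
    IsNilpotencyIndex (freeAlg (NAlt2 F) n) (n + 2) := by
  refine ⟨⟨by omega, power_freeAlg_eq_bot n⟩, ?_⟩
  rintro k ⟨hk, h⟩
  obtain ⟨m, rfl⟩ : ∃ m, n = m + 1 := ⟨n - 1, by omega⟩
  have hzero (a : (freeAlg (NAlt2 F) (m + 1)).carrier) (ys : List _) (hlen : ys.length + 1 = k) :
      mulR id ys a = 0 := by
    have hmem : mulR id ys a ∈ power (freeAlg (NAlt2 F) (m + 1)) k := by
      refine Submodule.subset_span ⟨leftNormed a ys, ?_, ?_⟩
      · rw [letters_leftNormed, Multiset.card_cons, Multiset.coe_card, hlen]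
      · rw [lift_leftNormed]
        rfl
    rw [h] at hmem
    exact (Submodule.mem_bot F).1 hmem
  by_contra! hlt
  obtain rfl | hk2 : k = 1 ∨ 2 ≤ k := by omega
  · apply mulR_freeGen_ne_zero (F := F) (n := m) (ys := []) (by simp)
    have h0 : freeGen F (m + 1) 0 = 0 := hzero _ [] rfl
    rw [h0, mulR_zero]
  · have hlen : (tailVars m).length = m := by simp [tailVars]
    -- Two copies of x_0 and k - 2 further distinct variables make a word of degree k; there are
    -- enough variables because k ≤ m + 2.
    have hnd : (0 :: (tailVars m).take (k - 2)).Nodup :=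
      (nodup_cons_tailVars m).sublist ((List.take_sublist _ _).cons_cons _)
    apply mulR_freeGen_ne_zero (F := F) hnd
    have h1 := hzero (freeGen F (m + 1) 0)
      (((tailVars m).take (k - 2) ++ [0]).map (freeGen F (m + 1))) (by simp [hlen]; omega)
    rwa [mulR_map, Function.id_comp] at h1

/-! ### The chain of subvarieties -/

omit [CharZero F] in
theorem satisfies_freeAlg_of_succ {n : ℕ} {f : FreeNonUnitalNonAssocAlgebra F ℕ}
    (hf : Satisfies (freeAlg (NAlt2 F) (n + 1)) f) : Satisfies (freeAlg (NAlt2 F) n) f := by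
  intro v
  let I := identityIdeal (NAlt2 F) (Fin n)
  let J := identityIdeal (NAlt2 F) (Fin (n + 1))
  choose p hp using fun i => I.proj_surjective (v i)
  let ι : FreeNonUnitalNonAssocAlgebra F (Fin n) →ₙₐ[F] FreeNonUnitalNonAssocAlgebra F (Fin (n + 1)) :=
    FreeNonUnitalNonAssocAlgebra.lift F fun i => FreeNonUnitalNonAssocAlgebra.of F i.castSucc
  have hv : v = I.projHom ∘ p := funext fun i => (hp i).symm
  have h1 := hf (J.projHom ∘ ι ∘ p)
  change FreeNonUnitalNonAssocAlgebra.lift F (J.projHom ∘ ι ∘ p) f = 0 at h1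
  rw [← map_lift, ← map_lift] at h1
  rw [hv]
  change FreeNonUnitalNonAssocAlgebra.lift F (I.projHom ∘ p) f = (0 : I.Quot)
  rw [← map_lift]
  refine (I.proj_eq_zero _).2 fun A hA u => ?_
  -- The lifted polynomials do not involve the last variable, so its value 0 is an arbitrary choice.
  have h2 := (J.proj_eq_zero _).1 h1 A hA (Fin.snoc u 0)
  rw [map_lift] at h2
  convert h2 using 3
  funext i
  simp [FreeNonUnitalNonAssocAlgebra.lift_of_apply]

theorem rankVariety_ssubset (n : ℕ) :
    rankVariety (NAlt2 F) n ⊂ rankVariety (NAlt2 F) (n + 1) := by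
  rw [Set.ssubset_iff_exists]
  refine ⟨fun B hB f hf => hB f (satisfies_freeAlg_of_succ hf),
    freeAlg (NAlt2 F) (n + 1), fun f hf => hf, fun h => ?_⟩
  have hlen : (tailVars n).length = n := by simp [tailVars]
  -- This word has degree n + 2, so it is an identity in rank n. In rank n + 1 it takes the nonzero
  -- value of `mulR_freeGen_ne_zero`.
  have h1 := h (monomial F (leftNormed 0 ((tailVars n ++ [0]).map Fin.val))) (fun v => by
    rw [lift_monomial]
    refine lift_eq_zero_of_freeAlg v _ ?_
    rw [letters_leftNormed, Multiset.card_cons, Multiset.coe_card]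
    simp [hlen]) fun i => if h : i < n + 1 then freeGen F (n + 1) ⟨i, h⟩ else 0
  rw [lift_monomial, lift_leftNormed, mulR_map] at h1
  refine mulR_freeGen_ne_zero (F := F) (nodup_cons_tailVars n) ?_
  rw [dif_pos (Nat.succ_pos n)] at h1
  convert h1 using 2
  swap
  · rfl
  funext i
  change _ = if h : (i : ℕ) < n + 1 then freeGen F (n + 1) ⟨i, h⟩ else 0
  rw [dif_pos i.2]

end
end NilAlt

namespace NilAlt
universe u

noncomputable section

variable {F : Type u} [Field F]

/-! ## Free superalgebras -/

section FreeSuper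
variable {V : Set (Alg F)} {r s : ℕ}

/-- The homomorphism from a free superalgebra determined by homogeneous values of the
generators. -/
def superHom {B : SuperAlg F} (hB : B ∈ superClass V) {v : Fin r ⊕ Fin s → B.carrier}
    (hv : IsGraded B v) : (freeSuper V r s).carrier →ₙₐ[F] B.carrier :=
  (superIdentityIdeal V r s).liftHom (FreeNonUnitalNonAssocAlgebra.lift F v)
    fun _ hf => hf B hB v hv

theorem superHom_mem {B : SuperAlg F} (hB : B ∈ superClass V) {v : Fin r ⊕ Fin s → B.carrier}
    (hv : IsGraded B v) (i : ZMod 2) (a : (freeSuper V r s).carrier)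
    (ha : a ∈ (freeSuper V r s).part i) : superHom hB hv a ∈ B.part i := by
  obtain ⟨f, hf, rfl⟩ := ha
  exact lift_mem_part B hv hf

variable (V r s) in
/-- The generators of a free superalgebra. -/
def superGen (i : Fin r ⊕ Fin s) : (freeSuper V r s).carrier :=
  (superIdentityIdeal V r s).projHom (FreeNonUnitalNonAssocAlgebra.of F i)

theorem superHom_superGen {B : SuperAlg F} (hB : B ∈ superClass V) {v : Fin r ⊕ Fin s → B.carrier}
    (hv : IsGraded B v) (i : Fin r ⊕ Fin s) : superHom hB hv (superGen V r s i) = v i :=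
  FreeNonUnitalNonAssocAlgebra.lift_of_apply F v i

theorem superGen_inr_mem (i : Fin s) : superGen V r s (.inr i) ∈ (freeSuper V r s).part 1 :=
  ⟨FreeNonUnitalNonAssocAlgebra.of F (.inr i), Submodule.subset_span ⟨FreeMagma.of (.inr i), by
    rw [parity, letters_of, ← Multiset.cons_zero, Multiset.countP_cons]
    simp, rfl⟩, rfl⟩

theorem eq_zero_of_superHom {a : (freeSuper V r s).carrier}
    (h : ∀ (B : SuperAlg F) (hB : B ∈ superClass V) (v : Fin r ⊕ Fin s → B.carrier)
      (hv : IsGraded B v), superHom hB hv a = 0) : a = 0 := by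
  obtain ⟨f, rfl⟩ := (superIdentityIdeal V r s).proj_surjective a
  exact ((superIdentityIdeal V r s).proj_eq_zero f).2 fun B hB v hv => h B hB v hv

/-- A linear functional on the Grassmann algebra, applied to the first factor. -/
def contract (A : Alg F) (ξ : Grassmann F →ₗ[F] F) : Grassmann F ⊗[F] A.carrier →ₗ[F] A.carrier :=
  TensorProduct.lid F A.carrier ∘ₗ LinearMap.rTensor A.carrier ξ

theorem contract_tmul (A : Alg F) (ξ : Grassmann F →ₗ[F] F) (g : Grassmann F) (a : A.carrier) :
    contract A ξ (g ⊗ₜ[F] a) = ξ g • a := rfl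

theorem contract_tensorHom {A B : Alg F} (ξ : Grassmann F →ₗ[F] F) (φ : A.carrier →ₙₐ[F] B.carrier)
    (a : Grassmann F ⊗[F] A.carrier) : contract B ξ (tensorHom φ a) = φ (contract A ξ a) := by
  induction a using TensorProduct.induction_on with
  | zero => simp only [map_zero]
  | add a a' h h' => simp only [map_add, h, h']
  | tmul g x => rw [tensorHom_tmul, contract_tmul, contract_tmul, map_smul]

/-- The coordinate functionals of a basis of the Grassmann algebra already separate tensors. -/
theorem eq_zero_of_contract {A : Alg F} {a : Grassmann F ⊗[F] A.carrier}
    (h : ∀ ξ, contract A ξ a = 0) : a = 0 := by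
  classical
  let b := Module.Basis.ofVectorSpace F (Grassmann F)
  apply (TensorProduct.equivFinsuppOfBasisLeft (N := A.carrier) b).injective
  rw [map_zero]
  ext i
  rw [Finsupp.zero_apply, TensorProduct.equivFinsuppOfBasisLeft_apply]
  exact h (b.coord i)

/-- Contractions commute with maps induced by superalgebra homomorphisms, and homomorphisms to
V-superalgebras separate the points of the free one. Hence an identity can be checked in envelopes
already known to lie in V. -/
theorem envelope_freeSuper_eq_zero {a : (envelope (freeSuper V r s)).carrier}
    (h : ∀ (B : SuperAlg F) (hB : B ∈ superClass V) (v : Fin r ⊕ Fin s → B.carrier)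
      (hv : IsGraded B v), envelopeMap (superHom hB hv) (superHom_mem hB hv) a = 0) : a = 0 := by
  refine Subtype.ext (eq_zero_of_contract (A := (freeSuper V r s).toAlg) fun ξ =>
    eq_zero_of_superHom fun B hB v hv => ?_)
  have h1 := congrArg Subtype.val (h B hB v hv)
  have h2 := contract_tensorHom (A := (freeSuper V r s).toAlg) (B := B.toAlg) ξ (superHom hB hv) a.1
  rw [← h2]
  change contract B.toAlg ξ (envelopeMap (superHom hB hv) (superHom_mem hB hv) a).1 = 0
  rw [h1]
  exact map_zero _

theorem freeSuper_mem (r s : ℕ) : freeSuper (NAlt2 F) r s ∈ superClass (NAlt2 F) := by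
  refine ⟨fun x y => ?_, fun x y => ?_, fun x y z t => ?_, fun x => ?_⟩
  all_goals
    refine envelope_freeSuper_eq_zero fun B hB v hv => ?_
    simp only [map_sub, map_mul]
  exacts [hB.1 _ _, hB.2.1 _ _, hB.2.2.1 _ _ _ _, hB.2.2.2 _]

end FreeSuper

/-! ## Superidentities of free superalgebras on even generators -/

section Even
variable [CharZero F]

/-- Even elements embed multiplicatively into the envelope by b ↦ 1 ⊗ b, so the nilpotency bound of
ordinary algebras applies. -/
theorem lift_even_eq_zero {B : SuperAlg F} (hB : B ∈ superClass (NAlt2 F)) {r : ℕ}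
    {v : Fin r ⊕ Fin 0 → B.carrier} (hv : IsGraded B v) (w : FreeMagma (Fin r ⊕ Fin 0))
    (hw : r + 2 ≤ (letters w).card) : FreeMagma.lift v w = 0 := by
  have hv' : ∀ i, v i ∈ B.part 0 := by
    rintro (i | i)
    exacts [hv.1 i, i.elim0]
  let v' : Fin r ⊕ Fin 0 → (envelope B).carrier := fun i =>
    ⟨1 ⊗ₜ[F] v i, tmul_mem_envelope Grassmann.one_mem (hv' i)⟩
  have h1 : FreeMagma.lift v' w = 0 := lift_eq_zero v' hB w (by simpa using hw)
  have h2 : ∀ u, (FreeMagma.lift v' u).1 = 1 ⊗ₜ[F] FreeMagma.lift v u := by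
    intro u
    induction u using FreeMagma.recOnMul with
    | ih1 x => rfl
    | ih2 u₁ u₂ h₁ h₂ =>
      rw [map_mul, map_mul]
      change (FreeMagma.lift v' u₁).1 * (FreeMagma.lift v' u₂).1 = _
      rw [h₁, h₂, Algebra.TensorProduct.tmul_mul_tmul, one_mul]
  have h3 := h2 w
  rw [h1] at h3
  -- Contracting with the augmentation, which sends 1 to 1, recovers b from 1 ⊗ b.
  have h4 := congrArg (contract B.toAlg (ExteriorAlgebra.algebraMapInv (R := F)).toLinearMap) h3
  change contract B.toAlg _ 0 = _ at h4
  rw [contract_tmul, map_zero, AlgHom.toLinearMap_apply, map_one, one_smul] at h4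
  exact h4.symm

theorem degreeSpan_super_eq_bot (r : ℕ) :
    degreeSpan (superIdentityIdeal (NAlt2 F) r 0) (r + 2) = ⊥ := by
  rw [degreeSpan, Submodule.span_eq_bot]
  rintro _ ⟨w, hw, rfl⟩
  rw [AlgIdeal.proj_eq_zero]
  intro B hB v hv
  rw [lift_monomial]
  exact lift_even_eq_zero hB hv w hw

omit [CharZero F] in
theorem map₂_tensor_mul_mem {A : Alg F} {P Q R : Submodule F A.carrier}
    (hPQ : ∀ x ∈ P, ∀ y ∈ Q, x * y ∈ R) {a b : Grassmann F ⊗[F] A.carrier}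
    (ha : a ∈ Submodule.map₂ (TensorProduct.mk F (Grassmann F) A.carrier) ⊤ P)
    (hb : b ∈ Submodule.map₂ (TensorProduct.mk F (Grassmann F) A.carrier) ⊤ Q) :
    a * b ∈ Submodule.map₂ (TensorProduct.mk F (Grassmann F) A.carrier) ⊤ R := by
  rw [Submodule.map₂_eq_span_image2] at ha hb
  induction ha using Submodule.span_induction with
  | zero => rw [zero_mul]; exact Submodule.zero_mem _
  | add a a' _ _ h h' => rw [add_mul]; exact Submodule.add_mem _ h h'
  | smul c a _ h => rw [smul_mul_assoc]; exact Submodule.smul_mem _ c h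
  | mem a ha =>
    obtain ⟨g, -, x, hx, rfl⟩ := ha
    induction hb using Submodule.span_induction with
    | zero => rw [mul_zero]; exact Submodule.zero_mem _
    | add b b' _ _ h h' => rw [mul_add]; exact Submodule.add_mem _ h h'
    | smul c b _ h => rw [mul_smul_comm]; exact Submodule.smul_mem _ c h
    | mem b hb =>
      obtain ⟨h, -, y, hy, rfl⟩ := hb
      change (g ⊗ₜ[F] x) * (h ⊗ₜ[F] y) ∈ _
      rw [Algebra.TensorProduct.tmul_mul_tmul]
      exact Submodule.apply_mem_map₂ _ trivial (hPQ x hx y hy)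

omit [CharZero F] in
theorem lift_envelope_mem {V : Set (Alg F)} {r s : ℕ} {Y : Type*}
    (v : Y → (envelope (freeSuper V r s)).carrier) (w : FreeMagma Y) :
    (FreeMagma.lift v w).1 ∈
      Submodule.map₂ (TensorProduct.mk F (Grassmann F) (freeSuper V r s).carrier) ⊤
        (degreeSpan (superIdentityIdeal V r s) (letters w).card) := by
  induction w using FreeMagma.recOnMul with
  | ih1 x =>
    rw [letters_of, Multiset.card_singleton, degreeSpan_one]
    have h := TensorProduct.map₂_mk_top_top_eq_top (R := F) (M := Grassmann F)
      (N := (freeSuper V r s).carrier)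
    exact h.ge trivial
  | ih2 u w hu hw =>
    rw [map_mul, letters_mul, Multiset.card_add]
    exact map₂_tensor_mul_mem (A := (freeSuper V r s).toAlg)
      (fun x hx y hy => degreeSpan_mul (superIdentityIdeal V r s) hx hy) hu hw

theorem lift_envelope_even_eq_zero {r : ℕ} {Y : Type*}
    (v : Y → (envelope (freeSuper (NAlt2 F) r 0)).carrier) (w : FreeMagma Y)
    (hw : (letters w).card = r + 2) : FreeMagma.lift v w = 0 := by
  have h := lift_envelope_mem v w
  rw [hw, degreeSpan_super_eq_bot] at h
  have hbot := Submodule.map₂_bot_right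
    (TensorProduct.mk F (Grassmann F) (freeSuper (NAlt2 F) r 0).carrier) ⊤
  exact Subtype.ext ((Submodule.mem_bot F).1 (hbot.le h))

omit [CharZero F] in
theorem normR_envelopeOdd_ne_zero {n : ℕ} {L : List (Fin n)} (hL : L.Nodup) (h2 : 2 ≤ L.length) :
    normR (fun i : Fin n => envelopeOdd F i) L ≠ 0 := by
  intro h
  match L with
  | [] => simp at h2
  | [_] => simp at h2
  | y :: z :: ys =>
    obtain ⟨j, -, h3⟩ := Model.normR_eq (y := y) (z := z) (ys := ys)
      (g := fun i : Fin n => Grassmann.gen F i)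
      (w := envelopeCoords ∘ fun i : Fin n => envelopeOdd F i)
      (fun t _ => Grassmann.gen_mem _) (fun t _ => envelopeCoords_odd _)
    have h1 := congrArg envelopeCoords h
    rw [map_normR, h3, map_zero] at h1
    exact (Model.IsUnitVec.iterate (Or.inl rfl) _).ne_zero
      (Model.vec_eq_zero (Model.coeffProd_gen_ne_zero hL) h1)

/-- The left-normed multilinear word of degree r + 2 vanishes in the envelope of the free
superalgebra on r even generators, but not at the elements e_i ⊗ x of the envelope of the model. -/
theorem rankSupervariety_even_ne (r : ℕ) :
    rankSupervariety (NAlt2 F) r 0 ≠ superClass (NAlt2 F) := by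
  intro h
  have hm : model F ∈ rankSupervariety (NAlt2 F) r 0 := h ▸ model_mem_superClass
  let w : FreeMagma (Fin (r + 2)) :=
    leftNormed (Fin.last (r + 1)) ((List.finRange (r + 1)).map Fin.castSucc)
  have hw : letters w = Finset.univ.val := by
    change _ = Multiset.ofList (List.finRange (r + 2))
    have hL := List.finRange_succ_last (n := r + 1)
    rw [letters_leftNormed, hL, Multiset.cons_coe, Multiset.coe_eq_coe]
    exact (List.perm_append_singleton _ _).symm
  have h1 := hm (r + 2) (monomial F w) (Submodule.subset_span ⟨w, hw, rfl⟩) (fun v => by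
    rw [lift_monomial]
    exact lift_envelope_even_eq_zero v w (by rw [hw]; simp)) fun i => envelopeOdd F i
  rw [lift_monomial, lift_leftNormed, ← normR_append, ← List.finRange_succ_last] at h1
  exact normR_envelopeOdd_ne_zero (List.nodup_finRange _) (by simp) h1

end Even

/-! ## Superidentities of the free superalgebra on one odd generator -/

section Odd

theorem projHom_mem_normSpan {n : ℕ} {f : FreeNonUnitalNonAssocAlgebra F (Fin n)}
    (hf : f ∈ multilinear F n) :
    (identityIdeal (NAlt2 F) (Fin n)).projHom f ∈
      normSpan (C := freeAlg (NAlt2 F) n) (freeGen F n) (List.finRange n) := by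
  induction hf using Submodule.span_induction with
  | zero => rw [map_zero]; exact Submodule.zero_mem _
  | add a b _ _ h h' => rw [map_add]; exact Submodule.add_mem _ h h'
  | smul c a _ h => rw [map_smul]; exact Submodule.smul_mem _ c h
  | mem f hf =>
    obtain ⟨w, hw, rfl⟩ := hf
    rw [← lift_projHom, lift_monomial]
    exact lift_mem_normSpan _ (freeAlg_mem n) w _ hw.symm

/-! ### Separating the spanning elements by standard substitutions -/

variable [CharZero F]

/-- Values in the envelope of the five-dimensional superalgebra that come from the free
superalgebra on one odd generator. -/
def IsStandard (a : (envelope (model F)).carrier) : Prop :=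
  (∃ i, a = envelopeOdd F i) ∨ a = envelopeEven F

omit [CharZero F] in
theorem unitVec_mul_self : unitVec F 0 * unitVec F 0 = unitVec F 1 := by
  have h (a : Model F) (ha : a = Model.mk (Pi.single 0 1)) : a * a = Model.mk (Pi.single 1 1) := by
    ext <;> simp [Model.mul_apply_zero, Model.mul_apply_one, Model.mul_apply_two,
      Model.mul_apply_three, Model.mul_apply_four, ha, Model.mk_apply]
  exact h _ rfl

omit [CharZero F] in
theorem exists_envelopeMap_eq {A B : SuperAlg F} (φ : A.carrier →ₙₐ[F] B.carrier)
    (hφ : ∀ i, ∀ a ∈ A.part i, φ a ∈ B.part i) {i : ZMod 2} {g : Grassmann F}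
    (hg : g ∈ Grassmann.part F i) {x : A.carrier} (hx : x ∈ A.part i) {y : B.carrier}
    (hxy : φ x = y) (b : (envelope B).carrier) (hb : b.1 = g ⊗ₜ[F] y) :
    ∃ a, envelopeMap φ hφ a = b := by
  subst hxy
  exact ⟨⟨g ⊗ₜ[F] x, tmul_mem_envelope hg hx⟩, Subtype.ext hb.symm⟩

/-- Standard values are images of the odd generator and its square, with Grassmann coefficients,
under the homomorphism to the model; so they lift to the envelope of the free superalgebra. -/
theorem lift_standard_eq_zero {n : ℕ} {f : FreeNonUnitalNonAssocAlgebra F (Fin n)}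
    (h : SatisfiesSuper (freeSuper (NAlt2 F) 0 1) f) {u : Fin n → (envelope (model F)).carrier}
    (hu : ∀ i, IsStandard (u i)) : FreeNonUnitalNonAssocAlgebra.lift F u f = 0 := by
  have hv : IsGraded (model F) (fun _ : Fin 0 ⊕ Fin 1 => unitVec F 0) :=
    ⟨fun i => i.elim0, fun _ => unitVec_mem 0⟩
  have hx := superGen_inr_mem (V := NAlt2 F) (r := 0) (s := 1) 0
  have hxx := (freeSuper (NAlt2 F) 0 1).mul_mem hx hx
  have hφ := superHom_superGen model_mem_superClass hv (.inr 0)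
  have hφ2 := map_mul (superHom model_mem_superClass hv) (superGen (NAlt2 F) 0 1 (.inr 0))
    (superGen (NAlt2 F) 0 1 (.inr 0))
  rw [hφ, unitVec_mul_self] at hφ2
  have hex : ∀ i, ∃ a, envelopeMap (superHom model_mem_superClass hv)
      (superHom_mem model_mem_superClass hv) a = u i := by
    intro i
    rcases hu i with ⟨j, hj⟩ | hj
    · exact exists_envelopeMap_eq _ _ (Grassmann.gen_mem j) hx hφ _ (congrArg Subtype.val hj)
    · exact exists_envelopeMap_eq _ _ Grassmann.one_mem hxx hφ2 _ (congrArg Subtype.val hj)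
  choose a ha using hex
  obtain rfl : envelopeMap (superHom model_mem_superClass hv)
      (superHom_mem model_mem_superClass hv) ∘ a = u := funext ha
  rw [← map_lift]
  have h1 : FreeNonUnitalNonAssocAlgebra.lift F a f = 0 := h a
  rw [h1, map_zero]

/-- Evaluation of the elements of a relatively free algebra in coordinates. -/
def evalCoords {n : ℕ} (u : Fin n → (envelope (model F)).carrier) :
    (freeAlg (NAlt2 F) n).carrier →ₙₐ[F] Model (Grassmann F) :=
  envelopeCoords.comp ((identityIdeal (NAlt2 F) (Fin n)).liftHom
    (FreeNonUnitalNonAssocAlgebra.lift F u) fun _ hf => hf _ model_mem_superClass u)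

theorem evalCoords_comp {n : ℕ} (u : Fin n → (envelope (model F)).carrier) :
    evalCoords u ∘ freeGen F n = envelopeCoords ∘ u := by
  funext i
  exact congrArg envelopeCoords (FreeNonUnitalNonAssocAlgebra.lift_of_apply F u i)

omit [CharZero F] in
theorem jordan_odd (g h : Grassmann F) (hg : g ∈ Grassmann.part F 1)
    (hh : h ∈ Grassmann.part F 1) : jordan (Model.odd g) (Model.odd h) = 0 := by
  rw [jordan, Model.odd_mul_odd, Model.odd_mul_odd, Grassmann.odd_mul_odd hg hh]
  ext <;> simp [Model.add_apply, Model.vec, Model.mk_apply, Model.zero_apply]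

omit [CharZero F] in
theorem jordan_odd_even {g : Grassmann F} (hg : g ∈ Grassmann.part F 1) :
    jordan (Model.odd g) (Model.vec 0 1 (1, 0)) = Model.vec 1 g (1, 1) := by
  rw [jordan, Model.odd_mul_vec Grassmann.one_mem hg, Model.vec_mul_odd, Model.vec_add, one_mul]
  congr 1
  ext <;> simp [Model.opL, Model.opR]

-- The conclusion is not c = d = 0 because `normR` or `normL` is zero by convention in low degree.
-- Above that range `IsUnitVec.independent` gives both coefficients.
omit [CharZero F] in
theorem norm_coeff_eq_zero {n : ℕ} {w : Fin n → Model (Grassmann F)} {L : List (Fin n)}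
    (hL : L.Nodup) (hw : ∀ i, w i = Model.odd (Grassmann.gen F i)) {A : Type*}
    [NonUnitalNonAssocRing A] [Module F A] (v : Fin n → A) {c d : F}
    (h : c • normR w L + d • normL w L = 0) : c • normR v L + d • normL v L = 0 := by
  have hg := Model.coeffProd_gen_ne_zero (F := F) hL
  match L with
  | [] => simp [normR, normL]
  | [x] =>
    have h0 := congrFun h 0
    simp only [normR, normL, hw, smul_zero, add_zero] at h0
    have h1 : c • Grassmann.gen F x = 0 := h0
    have h2 : c = 0 := (smul_eq_zero.1 h1).resolve_right (by simpa [Model.coeffProd] using hg)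
    simp [normL, h2]
  | [y, z] =>
    obtain ⟨j, -, h1⟩ := Model.normR_eq (y := y) (z := z) (ys := [])
      (g := fun i : Fin n => Grassmann.gen F i) (fun t _ => Grassmann.gen_mem _) (fun t _ => hw t)
    rw [h1, Model.smul_vec] at h
    simp only [normL, smul_zero, add_zero] at h ⊢
    have h2 := Model.vec_eq_zero hg h
    have h3 : c = 0 := by simpa [Prod.ext_iff] using h2
    rw [h3, zero_smul]
  | y :: z :: t :: ys =>
    obtain ⟨j, h1, h2⟩ := Model.normL_eq (y := y) (z := z) (t := t) (ys := ys)
      (g := fun i : Fin n => Grassmann.gen F i) (fun t _ => Grassmann.gen_mem _) (fun t _ => hw t)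
    rw [h1, h2, Model.smul_vec, Model.smul_vec, Model.vec_add] at h
    obtain ⟨rfl, rfl⟩ := (Model.IsUnitVec.iterate (Or.inl rfl) _).independent
      (Model.vec_eq_zero hg h)
    simp

omit [CharZero F] in
theorem mul_coeff_eq_zero {n : ℕ} {w : Fin n → Model (Grassmann F)} {x : Fin n}
    {ys : List (Fin n)} (hL : (x :: ys).Nodup)
    (hw : ∀ i ∈ ys, w i = Model.odd (Grassmann.gen F i)) {A : Type*}
    [NonUnitalNonAssocRing A] [Module F A] (v : Fin n → A) (a : A) {c d : F}
    (h : c • mulR w ys (Model.vec 1 (Grassmann.gen F x) (1, 1)) +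
      d • mulL w ys (Model.vec 1 (Grassmann.gen F x) (1, 1)) = 0) :
    c • mulR v ys a + d • mulL v ys a = 0 := by
  have hg := Model.gen_mul_coeffProd_ne_zero (F := F) hL
  match ys with
  | [] =>
    simp only [mulR, mulL, smul_zero, add_zero, Model.smul_vec] at h ⊢
    have h2 := Model.vec_eq_zero (by simpa [Model.coeffProd] using hg) h
    have h3 : c = 0 := by simpa [Prod.ext_iff] using h2
    rw [h3, zero_smul]
  | y :: ys =>
    obtain ⟨j, h1, h2⟩ := Model.mulL_vec (y := y) (ys := ys)
      (g := fun i : Fin n => Grassmann.gen F i) (fun t _ => Grassmann.gen_mem _) hw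
      (Grassmann.gen_mem x) (1, 1)
    rw [h1, h2, Model.smul_vec, Model.smul_vec, Model.vec_add] at h
    obtain ⟨rfl, rfl⟩ := (Model.IsUnitVec.iterate (Or.inr (Or.inr rfl)) _).independent
      (Model.vec_eq_zero hg h)
    simp

theorem eq_zero_of_mem_normSpan {n : ℕ} {q : (freeAlg (NAlt2 F) (n + 1)).carrier}
    (hq : q ∈ normSpan (freeGen F (n + 1)) (List.finRange (n + 1)))
    (h : ∀ u : Fin (n + 1) → (envelope (model F)).carrier, (∀ i, IsStandard (u i)) →
      evalCoords u q = 0) : q = 0 := by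
  have hnd := List.nodup_finRange (n + 1)
  obtain ⟨a, ha, ρ, hρ, rfl⟩ := Submodule.mem_sup.1 hq
  obtain ⟨c, d, rfl⟩ := Submodule.mem_span_pair.1 ha
  replace hρ := jordanSpan_le_rootedSpan _ (freeAlg_mem (n + 1)) (List.mem_finRange 0) hρ
  obtain ⟨p, hp, rfl⟩ := (Submodule.mem_iSup_iff_exists_finsupp _ _).1 hρ
  have hpu {u : Fin (n + 1) → (envelope (model F)).carrier}
      {b : {b // b ∈ (List.finRange (n + 1)).erase 0}} (h0 : u 0 = envelopeOdd F 0)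
      (hb : u (b : Fin (n + 1)) = envelopeOdd F (b : Fin (n + 1))) : evalCoords u (p b) = 0 := by
    obtain ⟨c, d, h1⟩ := Submodule.mem_span_pair.1 (hp b)
    have hj : jordan (evalCoords u (freeGen F (n + 1) 0)) (evalCoords u (freeGen F (n + 1) b)) = 0 := by
      have e (i : Fin (n + 1)) := congrFun (evalCoords_comp u) i
      simp only [Function.comp_apply] at e
      rw [e, e, h0, hb, envelopeCoords_odd, envelopeCoords_odd]
      exact jordan_odd _ _ (Grassmann.gen_mem _) (Grassmann.gen_mem _)
    rw [← h1, map_add, map_smul, map_smul, map_mulR, map_mulL, map_jordan, hj, mulR_zero, mulL_zero,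
      smul_zero, smul_zero, add_zero]
  have hnorm : c • normR (freeGen F (n + 1)) (List.finRange (n + 1)) +
      d • normL (freeGen F (n + 1)) (List.finRange (n + 1)) = 0 := by
    -- All variables odd: the Jordan part vanishes, since generators of the Grassmann algebra
    -- anticommute.
    let u : Fin (n + 1) → (envelope (model F)).carrier := fun i => envelopeOdd F i
    have h1 := h u fun i => Or.inl ⟨_, rfl⟩
    have h2 : evalCoords u (p.sum fun _ a => a) = 0 := by
      rw [Finsupp.sum, map_sum]
      exact Finset.sum_eq_zero fun b _ => hpu rfl rfl
    rw [map_add, h2, add_zero, map_add, map_smul, map_smul, map_normR, map_normL,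
      evalCoords_comp] at h1
    exact norm_coeff_eq_zero hnd (fun i => envelopeCoords_odd _) _ h1
  rw [hnorm, zero_add] at h ⊢
  have hzero : ∀ b, p b = 0 := by
    intro b
    have hb0 : (b : Fin (n + 1)) ≠ 0 := fun h0 => by
      have := b.2
      rw [h0] at this
      exact hnd.not_mem_erase this
    -- Making `b` even isolates `p b`: the other summands still contain a Jordan product of two odd
    -- values.
    let u : Fin (n + 1) → (envelope (model F)).carrier := fun i =>
      if i = b then envelopeEven F else envelopeOdd F i
    have hu {i : Fin (n + 1)} (hi : i ≠ b) : u i = envelopeOdd F i := if_neg hi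
    have hub : u b = envelopeEven F := if_pos rfl
    have h1 := h u fun i => by
      by_cases hi : i = b
      · exact Or.inr (by rw [hi, hub])
      · exact Or.inl ⟨_, hu hi⟩
    have h2 : evalCoords u (p.sum fun _ a => a) = evalCoords u (p b) := by
      rw [Finsupp.sum, map_sum]
      refine Finset.sum_eq_single b (fun b' _ hb' => ?_) fun hb => ?_
      · exact hpu (hu hb0.symm) (hu fun h => hb' (Subtype.ext h))
      · rw [Finsupp.notMem_support_iff.1 hb, map_zero]
    rw [h2] at h1
    obtain ⟨c, d, h3⟩ := Submodule.mem_span_pair.1 (hp b)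
    have hj : jordan (evalCoords u (freeGen F (n + 1) 0)) (evalCoords u (freeGen F (n + 1) b)) =
        Model.vec 1 (Grassmann.gen F (0 : Fin (n + 1))) (1, 1) := by
      have e (i : Fin (n + 1)) := congrFun (evalCoords_comp u) i
      simp only [Function.comp_apply] at e
      rw [e, e, hub, hu hb0.symm, envelopeCoords_odd, envelopeCoords_even]
      exact jordan_odd_even (Grassmann.gen_mem _)
    rw [← h3, map_add, map_smul, map_smul, map_mulR, map_mulL, map_jordan, hj,
      evalCoords_comp] at h1
    rw [← h3]
    have hnd2 := hnd.erase 0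
    refine mul_coeff_eq_zero ?_ ?_ _ _ h1
    · rw [List.nodup_cons]
      exact ⟨fun hm => hnd.not_mem_erase (List.mem_of_mem_erase hm), hnd2.erase _⟩
    · intro i hi
      have hib : i ≠ b := fun h => hnd2.not_mem_erase (h ▸ hi)
      rw [Function.comp_apply, hu hib, envelopeCoords_odd]
  exact Finset.sum_eq_zero fun b _ => hzero b

theorem satisfies_of_superIdentity {n : ℕ} {f : FreeNonUnitalNonAssocAlgebra F (Fin n)}
    (hf : f ∈ multilinear F n) (h : SatisfiesSuper (freeSuper (NAlt2 F) 0 1) f) {A : Alg F}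
    (hA : A ∈ NAlt2 F) : Satisfies A f := by
  suffices hq : (identityIdeal (NAlt2 F) (Fin n)).projHom f = 0 from
    ((identityIdeal (NAlt2 F) (Fin n)).proj_eq_zero f).1 hq A hA
  -- Rooting the Jordan words needs a variable; with none there are no words at all.
  cases n with
  | zero =>
    have hf0 : f = 0 := by
      have hbot : multilinear F 0 = ⊥ := by
        rw [multilinear, Submodule.span_eq_bot]
        rintro _ ⟨w, -, -⟩
        induction w using FreeMagma.recOnMul with
        | ih1 x => exact x.elim0
        | ih2 _ _ h _ => exact h
      rwa [hbot, Submodule.mem_bot] at hf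
    rw [hf0, map_zero]
  | succ n =>
    refine eq_zero_of_mem_normSpan (projHom_mem_normSpan hf) fun u hu => ?_
    change envelopeCoords (FreeNonUnitalNonAssocAlgebra.lift F u f) = 0
    rw [lift_standard_eq_zero h hu, map_zero]

/-! ### The linearized axioms as superidentities -/

omit [CharZero F] in
theorem monomial_mem_multilinear {n : ℕ} {w : FreeMagma (Fin n)}
    (hw : letters w = Finset.univ.val) : monomial F w ∈ multilinear F n :=
  Submodule.subset_span ⟨w, hw, rfl⟩

omit [CharZero F] in
theorem lift_of_mul_of_mul_of {n : ℕ} (A : Alg F) (v : Fin n → A.carrier) (i j k : Fin n) :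
    FreeNonUnitalNonAssocAlgebra.lift F v (monomial F (.of i * .of j * .of k)) =
      v i * v j * v k := by
  rw [lift_monomial, map_mul, map_mul, FreeMagma.lift_of, FreeMagma.lift_of, FreeMagma.lift_of]

omit [CharZero F] in
theorem lift_of_mul_of_mul_of' {n : ℕ} (A : Alg F) (v : Fin n → A.carrier) (i j k : Fin n) :
    FreeNonUnitalNonAssocAlgebra.lift F v (monomial F (.of i * (.of j * .of k))) =
      v i * (v j * v k) := by
  rw [lift_monomial, map_mul, map_mul, FreeMagma.lift_of, FreeMagma.lift_of, FreeMagma.lift_of]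

/-- The axioms are recovered from their multilinear forms by equating variables, which produces the
factors 2 and 6, invertible in characteristic 0. -/
theorem mem_superClass_of_mem_rankSupervariety {r s : ℕ} {B : SuperAlg F}
    (hB : B ∈ rankSupervariety (NAlt2 F) r s) : B ∈ superClass (NAlt2 F) := by
  have hE := freeSuper_mem (F := F) r s
  refine ⟨fun x y => ?_, fun x y => ?_, fun x y z t => ?_, fun x => ?_⟩
  · have h := hB 3 (monomial F (.of 0 * .of 1 * .of 2) + monomial F (.of 1 * .of 0 * .of 2) -
      (monomial F (.of 0 * (.of 1 * .of 2)) + monomial F (.of 1 * (.of 0 * .of 2))))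
      (Submodule.sub_mem _ (Submodule.add_mem _ (monomial_mem_multilinear (by decide))
        (monomial_mem_multilinear (by decide))) (Submodule.add_mem _
        (monomial_mem_multilinear (by decide)) (monomial_mem_multilinear (by decide))))
      (fun v => by
        simp only [map_sub, map_add, lift_of_mul_of_mul_of, lift_of_mul_of_mul_of']
        rw [sub_eq_zero]
        exact alt_left hE _ _ _) ![x, x, y]
    simp only [map_sub, map_add, lift_of_mul_of_mul_of, lift_of_mul_of_mul_of'] at h
    refine eq_zero_of_eq_neg (eq_neg_of_add_eq_zero_left ?_)
    rw [← h]
    change x * x * y - x * (x * y) + (x * x * y - x * (x * y)) =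
      x * x * y + x * x * y - (x * (x * y) + x * (x * y))
    abel
  · have h := hB 3 (monomial F (.of 0 * .of 1 * .of 2) + monomial F (.of 0 * .of 2 * .of 1) -
      (monomial F (.of 0 * (.of 1 * .of 2)) + monomial F (.of 0 * (.of 2 * .of 1))))
      (Submodule.sub_mem _ (Submodule.add_mem _ (monomial_mem_multilinear (by decide))
        (monomial_mem_multilinear (by decide))) (Submodule.add_mem _
        (monomial_mem_multilinear (by decide)) (monomial_mem_multilinear (by decide))))
      (fun v => by
        simp only [map_sub, map_add, lift_of_mul_of_mul_of, lift_of_mul_of_mul_of']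
        rw [sub_eq_zero]
        exact alt_right hE _ _ _) ![x, y, y]
    simp only [map_sub, map_add, lift_of_mul_of_mul_of, lift_of_mul_of_mul_of'] at h
    refine eq_zero_of_eq_neg (eq_neg_of_add_eq_zero_left ?_)
    rw [← h]
    change x * y * y - x * (y * y) + (x * y * y - x * (y * y)) =
      x * y * y + x * y * y - (x * (y * y) + x * (y * y))
    abel
  · have h := hB 4 (monomial F (.of 0 * .of 1 * (.of 2 * .of 3)))
      (monomial_mem_multilinear (by decide)) (fun v => by
        rw [lift_monomial]
        exact metabelian hE (v 0) (v 1) (v 2) (v 3)) ![x, y, z, t]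
    rwa [lift_monomial] at h
  · have h := hB 3 (monomial F (.of 0 * .of 1 * .of 2) + monomial F (.of 1 * .of 0 * .of 2) +
      (monomial F (.of 1 * .of 2 * .of 0) + monomial F (.of 2 * .of 1 * .of 0)) +
      (monomial F (.of 2 * .of 0 * .of 1) + monomial F (.of 0 * .of 2 * .of 1)))
      (Submodule.add_mem _ (Submodule.add_mem _ (Submodule.add_mem _
        (monomial_mem_multilinear (by decide)) (monomial_mem_multilinear (by decide)))
        (Submodule.add_mem _
        (monomial_mem_multilinear (by decide)) (monomial_mem_multilinear (by decide))))
        (Submodule.add_mem _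
        (monomial_mem_multilinear (by decide)) (monomial_mem_multilinear (by decide))))
      (fun v => by
        simp only [map_add, lift_of_mul_of_mul_of, ← add_mul]
        exact jordan_cyclic_right hE (v 0) (v 1) (v 2)) ![x, x, x]
    simp only [map_add, lift_of_mul_of_mul_of] at h
    have h6 : (6 : F) • (x * x * x) = 0 := by
      rw [← h]
      change (6 : F) • (x * x * x) = x * x * x + x * x * x + (x * x * x + x * x * x) +
        (x * x * x + x * x * x)
      module
    exact (smul_eq_zero.1 h6).resolve_left (by norm_num)

theorem rankSupervariety_odd : rankSupervariety (NAlt2 F) 0 1 = superClass (NAlt2 F) :=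
  Set.Subset.antisymm (fun _ hB => mem_superClass_of_mem_rankSupervariety hB)
    fun _ hB _ _ hf h => satisfies_of_superIdentity hf h hB

end Odd

/-! ### The basic spectrum -/

theorem basicSpectrum_eq [CharZero F] : basicSpectrum (NAlt2 F) = {((0, 1) : ℕ × ℕ)} := by
  -- Since s = 0 never generates, (0, 1) is the least generating pair and hence the only minimal
  -- one.
  have hle {r s : ℕ} (h : rankSupervariety (NAlt2 F) r s = superClass (NAlt2 F)) :
      ((0, 1) : ℕ × ℕ) ≤ (r, s) := by
    refine ⟨Nat.zero_le r, Nat.one_le_iff_ne_zero.2 ?_⟩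
    rintro rfl
    exact rankSupervariety_even_ne r h
  ext ⟨r, s⟩
  constructor
  · intro h
    have h' : Minimal (fun q : ℕ × ℕ => rankSupervariety (NAlt2 F) q.1 q.2 = superClass (NAlt2 F))
      (r, s) := h
    exact h'.eq_of_ge rankSupervariety_odd (hle h'.prop)
  · intro h
    obtain ⟨rfl, rfl⟩ := Prod.mk.inj (Set.mem_singleton_iff.1 h)
    exact ⟨rankSupervariety_odd, fun q hq _ => hle hq⟩

end
end NilAlt

theorem mainTheorem10 {F : Type*} [Field F] [CharZero F] :
    NilAlt.basicSpectrum (NilAlt.NAlt2 F) = {((0, 1) : ℕ × ℕ)} ∧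
    (∀ n : ℕ, 1 ≤ n →
      NilAlt.rankVariety (NilAlt.NAlt2 F) n ⊂ NilAlt.rankVariety (NilAlt.NAlt2 F) (n + 1)) ∧
    (∀ n : ℕ, 1 ≤ n →
      NilAlt.IsNilpotencyIndex (NilAlt.freeAlg (NilAlt.NAlt2 F) n) (n + 2)) :=
  ⟨NilAlt.basicSpectrum_eq, fun n _ => NilAlt.rankVariety_ssubset n,
    fun _ hn => NilAlt.isNilpotencyIndex_freeAlg hn⟩
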